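/- For a nonzero Laurent polynomial $P\in\mathbb{C}[x_1^{\pm1},\dots,x_n^{\pm1}]$ let $$m(P)=\int_{[0,1]^n}\log\bigl|P(e^{2\pi i\theta_1},\dots,e^{2\pi i\theta_n})\bigr|\,d\theta_1\cdots d\theta_n$$ be its (logarithmic) Mahler measure. Let $\mathrm{Li}_k$ be the classical polylogarithm ($\mathrm{Li}_1(x)=-\log(1-x)$, $\mathrm{Li}_{k+1}(x)=\int_0^x \mathrm{Li}_k(s)\,\frac{ds}{s}$, along the segment from $0$ to $x$, with the principal branch of the logarithm), let $B_j$ be the Bernoulli numbers ($B_1=-\tfrac12$), and let $$\mathcal{L}_3(x)=\mathrm{Re}\Bigl(\sum_{j=0}^{2}\frac{2^jB_j}{j!}(\log|x|)^j\,\mathrm{Li}_{3-j}(x)\Bigr)$$ be Zagier's modified trilogarithm (with $\mathcal{L}_3(1)$ understood by continuity, $\mathcal{L}_3(1)=\mathrm{Li}_3(1)$). Then, for the three-variable Laurent polynomials $$P_{\pm}=1+x+y^{-1}\pm(1+x+y)z,$$ the functions $\log|P_\pm|$ are integrable on the unit torus, and $$4\pi^2\,m(P_-)=4\mathcal{L}_3(1)-8\mathcal{L}_3(-1)+8\mathcal{L}_3(3)-4\mathcal{L}_3(-3),$$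 $$2\mathcal{L}_3(3)-\mathcal{L}_3(-3)=\frac{13}{6}\zeta(3),$$ $$m(P_-)=m(P_+)=\frac{14}{3\pi^2}\zeta(3).$$ -/

import Mathlib

open MeasureTheory

/-- Laurent polynomials with complex coefficients in `n` variables: the group algebra of `ℤⁿ`. -/
abbrev MvLaurent (n : ℕ) : Type := AddMonoidAlgebra ℂ (Fin n → ℤ)

/-- The coefficient-one monomial `∏ i, (x i) ^ (a i)`. -/
noncomputable def MvLaurent.monomial {n : ℕ} (a : Fin n → ℤ) : MvLaurent n :=
  AddMonoidAlgebra.single a 1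

/-- Evaluation of a Laurent polynomial at a point with nonzero coordinates. -/
noncomputable def MvLaurent.eval {n : ℕ} (u : Fin n → ℂˣ) : MvLaurent n →ₐ[ℂ] ℂ :=
  AddMonoidAlgebra.lift ℂ ℂ (Fin n → ℤ)
    { toFun := fun a => ((∏ i, u i ^ (Multiplicative.toAdd a i) : ℂˣ) : ℂ)
      map_one' := by simp
      map_mul' := fun a b => by
        simp [zpow_add, Finset.prod_mul_distrib] }

/-- The value of a Laurent polynomial is the finite sum of its terms. -/
theorem MvLaurent.eval_eq_sum {n : ℕ} (u : Fin n → ℂˣ) (P : MvLaurent n) :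
    MvLaurent.eval u P = P.coeff.sum fun a c => c * ∏ i, (u i : ℂ) ^ (a i) := by
  simp [MvLaurent.eval, AddMonoidAlgebra.lift_apply]

/-- The point `(exp (2πiθ₁), …, exp (2πiθₙ))` of the unit torus. -/
noncomputable def torusPoint {n : ℕ} (θ : Fin n → ℝ) : Fin n → ℂˣ := fun i =>
  Units.mk0 (Complex.exp (2 * Real.pi * Complex.I * θ i)) (Complex.exp_ne_zero _)

/-- The function `θ ↦ log |P(exp (2πiθ₁), …, exp (2πiθₙ))|`. -/
noncomputable def logAbsOnTorus {n : ℕ} (P : MvLaurent n) (θ : Fin n → ℝ) : ℝ :=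
  Real.log ‖MvLaurent.eval (torusPoint θ) P‖

/-- The logarithmic Mahler measure of a Laurent polynomial. -/
noncomputable def logMahler {n : ℕ} (P : MvLaurent n) : ℝ :=
  ∫ θ in Set.Icc (0 : Fin n → ℝ) 1, logAbsOnTorus P θ

/-- The variables `x`, `y`, `y⁻¹`, `z` of the ring of Laurent polynomials in three variables. -/
noncomputable def varX : MvLaurent 3 := MvLaurent.monomial ![1, 0, 0]
noncomputable def varY : MvLaurent 3 := MvLaurent.monomial ![0, 1, 0]
noncomputable def varYInv : MvLaurent 3 := MvLaurent.monomial ![0, -1, 0]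
noncomputable def varZ : MvLaurent 3 := MvLaurent.monomial ![0, 0, 1]

/-- The classical polylogarithm `Li_k` on its principal branch:
`Li_1(x) = -log(1 - x)` and `Li_(k+1)(x) = ∫ Li_k(s) ds/s` along the segment from `0` to `x`,
parametrized by `s = t x`. On the cut `(1, ∞)` this gives the boundary value from one side. -/
noncomputable def polylog : ℕ → ℂ → ℂ
  | 0, x => x / (1 - x)
  | 1, x => -Complex.log (1 - x)
  | k + 2, x => ∫ t in (0 : ℝ)..1, polylog (k + 1) (t * x) / t

/-- Zagier's single-valued modification `𝓛_n` of the polylogarithm: the real part (`n` odd) or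
the imaginary part (`n` even) of `∑_{j<n} (2^j B_j / j!) (log|x|)^j Li_{n-j}(x)`. -/
noncomputable def zagierL (n : ℕ) (x : ℂ) : ℝ :=
  let s : ℂ := ∑ j ∈ Finset.range n,
    (2 : ℂ) ^ j * (bernoulli j : ℂ) / (Nat.factorial j : ℂ) * (Real.log ‖x‖ : ℂ) ^ j
      * polylog (n - j) x
  if Odd n then s.re else s.im

open MeasureTheory

/-! In z both polynomials are linear: P± = A ± Bz with A = 1 + x + 1/y and B = 1 + x + y. Jensen's
formula (`integral_prod_log_norm`) turns m(P±) into the mean of log max(|A|, |B|), whatever the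
sign. For angles a, b in [0, π] one has |B|² - |A|² = 4 sin a sin b ≥ 0, and reflecting either angle
swaps |A| and |B|. So 4π² m(P±) is four times the integral of log|1 + e^(ia) + e^(ib)| over [0, π]².

Integration by parts in b and an explicit integral in a make this one-dimensional. Cauchy's theorem
for `arcFun` on the half-strip Re z < 0, 0 < Im z < π then moves it to the horizontal edges, where
it reads ∫ α(α - β) dt/t over (0, 2), with α = log|1 - t| and β = log(1 + t).

Write K(a, b) for the integral of log²|u|/(1 - u) from a to b. Expanding α(α - β) leaves K(-1, 1) =
7/2 ζ(3) and the combination K(1, 3) + K(-3, -1)/2. The identity (α - β)² + (α + β)² = 2α² + 2β²,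
integrated against dt/t, determines that combination (`integral_logKernel_relation`).

On the real axis 𝓛₃ is K plus an elementary term (`zagierL_three_eq`), and 2𝓛₃(3) - 𝓛₃(-3) involves
the same combination, the elementary terms cancelling because 1 + 3 = (1 - 3)². All quantities are
thus explicit multiples of ζ(3). -/

/-! ### The integral of log² u / (1 - u) over (0, 1) and ζ(3) -/

theorem sq_log_div_one_sub_le {u : ℝ} (h0 : 0 < u) (h1 : u < 1) :
    Real.log u ^ 2 / (1 - u) ≤ 16 * u ^ (-(1 / 2) : ℝ) := by
  -- The bound log y⁻¹ ≤ y⁻¹ - 1, squared, costs y⁻²; with a fourth root this is u^(-1/2), still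
  -- integrable at 0.
  set y := u ^ (1 / 4 : ℝ) with hy
  have y0 : 0 < y := Real.rpow_pos_of_pos h0 _
  have hu : u = y ^ 4 := by
    rw [hy, ← Real.rpow_natCast, ← Real.rpow_mul h0.le]; norm_num
  have y1 : y < 1 := Real.rpow_lt_one h0.le h1 (by norm_num)
  have e1 : u ^ (-(1 / 2) : ℝ) = (y ^ 2)⁻¹ := by
    rw [hy, ← Real.rpow_natCast, ← Real.rpow_mul h0.le, ← Real.rpow_neg h0.le]; norm_num
  have e2 : Real.log u = 4 * Real.log y := by rw [hu, Real.log_pow]; norm_num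
  have b1 : Real.log y ≤ 0 := Real.log_nonpos y0.le y1.le
  have b2 : -Real.log y ≤ y⁻¹ - 1 := by
    rw [← Real.log_inv]; exact Real.log_le_sub_one_of_pos (by positivity)
  have b3 : Real.log y ^ 2 ≤ (y⁻¹ - 1) ^ 2 := by
    rw [← neg_sq]; exact pow_le_pow_left₀ (by linarith) b2 2
  rw [e1, e2, hu, div_le_iff₀ (by nlinarith [pow_lt_one₀ y0.le y1 (n := 4) (by norm_num)])]
  have b4 : (y⁻¹ - 1) ^ 2 ≤ (y ^ 2)⁻¹ * (1 - y ^ 4) := by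
    have : (y⁻¹ - 1) ^ 2 = (y ^ 2)⁻¹ * (1 - y) ^ 2 := by field_simp
    rw [this]
    refine mul_le_mul_of_nonneg_left ?_ (by positivity)
    nlinarith [mul_pos y0 (sub_pos.2 y1), pow_le_one₀ y0.le y1.le (n := 3),
      mul_le_mul_of_nonneg_left (pow_le_one₀ y0.le y1.le (n := 3)) y0.le]
  calc (4 * Real.log y) ^ 2 = 16 * Real.log y ^ 2 := by ring
    _ ≤ 16 * ((y ^ 2)⁻¹ * (1 - y ^ 4)) := by linarith
    _ = _ := by ring

theorem integrableOn_sq_log_div_one_sub :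
    IntegrableOn (fun u : ℝ => Real.log u ^ 2 / (1 - u)) (Set.Ioo 0 1) := by
  have hd : IntegrableOn (fun u : ℝ => 16 * u ^ (-(1 / 2) : ℝ)) (Set.Ioo 0 1) := by
    have := (intervalIntegral.intervalIntegrable_rpow' (a := 0) (b := 1)
      (r := -(1 / 2)) (by norm_num)).const_mul 16
    rw [intervalIntegrable_iff_integrableOn_Ioo_of_le zero_le_one] at this
    exact this
  refine Integrable.mono' hd (Measurable.aestronglyMeasurable (by fun_prop)) ?_
  filter_upwards [ae_restrict_mem measurableSet_Ioo] with u hu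
  rw [Real.norm_of_nonneg (div_nonneg (sq_nonneg _) (by linarith [hu.2]))]
  exact sq_log_div_one_sub_le hu.1 hu.2

/-- The value `ζ(3)` as a real number. -/
noncomputable def zetaThree : ℝ := ∑' n : ℕ, 1 / ((n : ℝ) + 1) ^ 3

theorem ofReal_zetaThree : (zetaThree : ℂ) = riemannZeta 3 := by
  have h := zeta_eq_tsum_one_div_nat_add_one_cpow (s := 3) (by norm_num)
  rw [h, zetaThree, Complex.ofReal_tsum]
  refine tsum_congr fun n => ?_
  have : (3 : ℂ) = ((3 : ℕ) : ℂ) := by norm_num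
  rw [this, Complex.cpow_natCast]
  push_cast; ring

theorem image_exp_neg_Ioi : (fun t : ℝ => Real.exp (-t)) '' Set.Ioi 0 = Set.Ioo 0 1 := by
  ext u
  constructor
  · rintro ⟨t, ht, rfl⟩
    exact ⟨Real.exp_pos _, by simpa using ht⟩
  · rintro ⟨h0, h1⟩
    exact ⟨-Real.log u, by simpa using Real.log_neg h0 h1, by simp [Real.exp_log h0]⟩

/-- Under u = e^(-t) this is the Mellin transform at 3 of e^(-t)/(1 - e^(-t)) = ∑ e^(-(n+1)t), that
is Γ(3) ζ(3). -/
theorem integral_sq_log_div_one_sub :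
    ∫ u in Set.Ioo (0 : ℝ) 1, Real.log u ^ 2 / (1 - u) = 2 * zetaThree := by
  have hsum : Summable fun n : ℕ => ‖(1 : ℂ)‖ / ((n : ℝ) + 1) ^ (3 : ℂ).re := by
    have := (summable_nat_add_iff 1).2 (Real.summable_one_div_nat_pow.2 (by norm_num : 1 < 3))
    refine this.congr fun n => ?_
    have : (3 : ℂ).re = ((3 : ℕ) : ℝ) := by norm_num
    rw [this, Real.rpow_natCast]; simp
  have hm := hasSum_mellin (a := fun _ : ℕ => (1 : ℂ)) (p := fun n : ℕ => (n : ℝ) + 1)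
    (F := fun t => ((Real.exp (-t) / (1 - Real.exp (-t)) : ℝ) : ℂ)) (s := 3)
    (fun n => Or.inr (by positivity)) (by norm_num) (fun t ht => ?_) hsum
  · have e1 : mellin (fun t : ℝ => ((Real.exp (-t) / (1 - Real.exp (-t)) : ℝ) : ℂ)) 3
        = ((∫ u in Set.Ioo (0 : ℝ) 1, Real.log u ^ 2 / (1 - u) : ℝ) : ℂ) := by
      rw [← image_exp_neg_Ioi, integral_image_eq_integral_abs_deriv_smul measurableSet_Ioi
        (f' := fun t => -Real.exp (-t)) (fun t _ => ?_) (fun a _ b _ h => ?_), mellin,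
        ← integral_complex_ofReal]
      · refine setIntegral_congr_fun measurableSet_Ioi fun t _ => ?_
        have : (3 : ℂ) - 1 = ((2 : ℕ) : ℂ) := by norm_num
        simp only [this, Complex.cpow_natCast, abs_neg, abs_of_pos (Real.exp_pos _), smul_eq_mul,
          Real.log_exp]
        push_cast; ring
      · simpa using (hasDerivAt_neg t).exp.hasDerivWithinAt
      · simpa using h
    have e2 : HasSum (fun i : ℕ => Complex.Gamma 3 * 1 / (((i : ℝ) + 1 : ℝ) : ℂ) ^ (3 : ℂ))
        (2 * riemannZeta 3) := by
      have h3 := zeta_eq_tsum_one_div_nat_add_one_cpow (s := 3) (by norm_num)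
      rw [h3, ← tsum_mul_left]
      have hG : Complex.Gamma 3 = 2 := by
        have := Complex.Gamma_nat_eq_factorial 2
        rw [show ((2 : ℕ) : ℂ) + 1 = 3 by norm_num] at this
        rw [this]; norm_num
      have : (fun i : ℕ => Complex.Gamma 3 * 1 / (((i : ℝ) + 1 : ℝ) : ℂ) ^ (3 : ℂ))
          = fun i : ℕ => 2 * (1 / ((i : ℂ) + 1) ^ (3 : ℂ)) := by
        funext i; rw [hG]; push_cast; ring
      rw [← this]
      exact hm.summable.hasSum
    have := hm.unique e2
    rw [e1, ← ofReal_zetaThree] at this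
    exact_mod_cast this
  · have h1 : Real.exp (-t) < 1 := by simpa using ht
    have := (hasSum_geometric_of_lt_one (Real.exp_pos _).le h1).mul_left (Real.exp (-t))
    rw [← div_eq_mul_inv] at this
    have h2 := (Complex.hasSum_ofReal).2 this
    convert! h2 using 2 with n
    rw [one_mul, ← Real.exp_nat_mul, ← Real.exp_add]
    congr 2; ring

/-- A change of variables between bounded intervals, for an injective differentiable map. -/
theorem intervalIntegral_subst {φ φ' g : ℝ → ℝ} {a b c d : ℝ} (hab : a ≤ b) (hcd : c ≤ d)
    (him : φ '' Set.Ioo a b = Set.Ioo c d) (hφ : ∀ t ∈ Set.Ioo a b, HasDerivAt φ (φ' t) t)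
    (hinj : Set.InjOn φ (Set.Ioo a b)) :
    (IntervalIntegrable g volume c d ↔
      IntervalIntegrable (fun t => |φ' t| * g (φ t)) volume a b) ∧
    ∫ u in c..d, g u = ∫ t in a..b, |φ' t| * g (φ t) := by
  rw [intervalIntegrable_iff_integrableOn_Ioo_of_le hab,
    intervalIntegrable_iff_integrableOn_Ioo_of_le hcd,
    intervalIntegral.integral_of_le hab, intervalIntegral.integral_of_le hcd,
    integral_Ioc_eq_integral_Ioo, integral_Ioc_eq_integral_Ioo, ← him]
  exact ⟨integrableOn_image_iff_integrableOn_abs_deriv_smul measurableSet_Ioo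
      (fun t ht => (hφ t ht).hasDerivWithinAt) hinj g,
    integral_image_eq_integral_abs_deriv_smul measurableSet_Ioo
      (fun t ht => (hφ t ht).hasDerivWithinAt) hinj g⟩

/-! ### The kernel log² |u| / (1 - u) on [-3, 3] -/

/-- The kernel `log² |u| / (1 - u)`. -/
noncomputable def logKernel (u : ℝ) : ℝ := Real.log u ^ 2 / (1 - u)

theorem measurable_logKernel : Measurable logKernel := by unfold logKernel; fun_prop

theorem intervalIntegrable_logKernel_zero_one : IntervalIntegrable logKernel volume 0 1 :=
  (intervalIntegrable_iff_integrableOn_Ioo_of_le zero_le_one).2 integrableOn_sq_log_div_one_sub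

theorem integral_logKernel_zero_one : ∫ u in (0 : ℝ)..1, logKernel u = 2 * zetaThree := by
  rw [intervalIntegral.integral_of_le zero_le_one, integral_Ioc_eq_integral_Ioo]
  exact integral_sq_log_div_one_sub

/-- Keeps the kernel bounded to the right of 1, where its denominator vanishes. -/
theorem sq_log_le {u : ℝ} (hu : 1 < u) : Real.log u ^ 2 ≤ (u - 1) ^ 2 :=
  pow_le_pow_left₀ (Real.log_nonneg hu.le) (Real.log_le_sub_one_of_pos (by linarith)) 2

theorem intervalIntegrable_logKernel_one_three : IntervalIntegrable logKernel volume 1 3 := by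
  rw [intervalIntegrable_iff_integrableOn_Ioo_of_le (by norm_num)]
  refine Measure.integrableOn_of_bounded (M := 2) (by simp)
    measurable_logKernel.aestronglyMeasurable ?_
  filter_upwards [ae_restrict_mem measurableSet_Ioo] with u hu
  rw [logKernel, norm_div, Real.norm_of_nonneg (sq_nonneg _), Real.norm_eq_abs,
    abs_of_neg (by linarith [hu.1]), div_le_iff₀ (by linarith [hu.1])]
  nlinarith [sq_log_le hu.1, hu.1, hu.2]

theorem intervalIntegrable_logKernel_neg_zero_one :
    IntervalIntegrable (fun u => logKernel (-u)) volume 0 1 := by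
  have h := intervalIntegrable_logKernel_zero_one
  rw [intervalIntegrable_iff_integrableOn_Ioo_of_le zero_le_one] at h ⊢
  refine Integrable.mono h (measurable_logKernel.comp measurable_neg).aestronglyMeasurable ?_
  filter_upwards [ae_restrict_mem measurableSet_Ioo] with u hu
  rw [logKernel, logKernel, norm_div, norm_div, Real.log_neg_eq_log, Real.norm_eq_abs (1 - -u),
    Real.norm_eq_abs (1 - u), abs_of_pos (by linarith [hu.1]), abs_of_pos (by linarith [hu.2])]
  exact div_le_div_of_nonneg_left (norm_nonneg _) (by linarith [hu.2]) (by linarith [hu.1])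

theorem intervalIntegrable_logKernel_neg_one_three :
    IntervalIntegrable (fun u => logKernel (-u)) volume 1 3 := by
  rw [intervalIntegrable_iff_integrableOn_Ioo_of_le (by norm_num)]
  refine Measure.integrableOn_of_bounded (M := 4) (by simp)
    (measurable_logKernel.comp measurable_neg).aestronglyMeasurable ?_
  filter_upwards [ae_restrict_mem measurableSet_Ioo] with u hu
  rw [logKernel, norm_div, Real.norm_of_nonneg (sq_nonneg _), Real.norm_eq_abs,
    abs_of_pos (by linarith [hu.1]), div_le_iff₀ (by linarith [hu.1]), Real.log_neg_eq_log]
  nlinarith [sq_log_le hu.1, hu.1, hu.2]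

theorem intervalIntegrable_logKernel {a b : ℝ} (ha : a ∈ Set.Icc (-3 : ℝ) 3)
    (hb : b ∈ Set.Icc (-3 : ℝ) 3) : IntervalIntegrable logKernel volume a b := by
  have h1 := intervalIntegrable_logKernel_zero_one.trans intervalIntegrable_logKernel_one_three
  have h2 := intervalIntegrable_logKernel_neg_zero_one.trans
    intervalIntegrable_logKernel_neg_one_three
  have h3 : IntervalIntegrable logKernel volume (-3) 0 := by
    have := ((IntervalIntegrable.iff_comp_neg (f := fun u => logKernel (-u))).1 h2).symm
    simpa using this
  refine (h3.trans h1).mono_set ?_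
  rw [Set.uIcc_of_le (by norm_num : (-3 : ℝ) ≤ 3)]
  exact Set.uIcc_subset_Icc ha hb

theorem logKernel_even_part {w : ℝ} (h1 : w ≠ 1) (h2 : w ≠ -1) :
    logKernel w + logKernel (-w) = 2 * Real.log w ^ 2 / (1 - w ^ 2) := by
  have e1 : 1 - w ≠ 0 := sub_ne_zero.2 h1.symm
  have e2 : 1 + w ≠ 0 := fun h => h2 (by linarith)
  have e3 : 1 - w ^ 2 ≠ 0 := by
    rw [show 1 - w ^ 2 = (1 - w) * (1 + w) by ring]; exact mul_ne_zero e1 e2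
  rw [logKernel, logKernel, Real.log_neg_eq_log, sub_neg_eq_add]
  field_simp; ring

theorem integral_comp_sq {g : ℝ → ℝ} {c : ℝ} (hc : 0 < c) :
    (IntervalIntegrable g volume 0 (c ^ 2) ↔
      IntervalIntegrable (fun t => |2 * t| * g (t ^ 2)) volume 0 c) ∧
    ∫ u in 0..c ^ 2, g u = ∫ t in 0..c, |2 * t| * g (t ^ 2) := by
  refine intervalIntegral_subst (φ := fun t => t ^ 2) hc.le (by positivity) ?_ (fun t _ => ?_) ?_
  · ext u
    constructor
    · rintro ⟨t, ht, rfl⟩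
      exact ⟨pow_pos ht.1 2, pow_lt_pow_left₀ ht.2 ht.1.le two_ne_zero⟩
    · rintro ⟨h0, h1⟩
      exact ⟨√u, ⟨Real.sqrt_pos.2 h0, (Real.sqrt_lt' hc).2 h1⟩, Real.sq_sqrt h0.le⟩
  · simpa using hasDerivAt_pow 2 t
  · intro x hx y hy h
    exact (pow_left_inj₀ hx.1.le hy.1.le two_ne_zero).1 h

/-- Since 2t/(1 - t²) = 1/(1 - t) - 1/(1 + t) and log² t² = 4 log² t, the substitution u = t² gives
K(0, 1) = 4(K(0, 1) - X) for the integral X sought. -/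
theorem integral_logKernel_neg_zero_one :
    ∫ u in (0 : ℝ)..1, logKernel (-u) = 3 / 2 * zetaThree := by
  have h := (integral_comp_sq (g := logKernel) one_pos).2
  have e : ∫ t in (0 : ℝ)..1, |2 * t| * logKernel (t ^ 2)
      = ∫ t in (0 : ℝ)..1, 4 * (logKernel t - logKernel (-t)) := by
    refine intervalIntegral.integral_congr_Ioo_of_le zero_le_one fun t ht => ?_
    have e1 : 1 - t ≠ 0 := by linarith [ht.2]
    have e2 : 1 + t ≠ 0 := by linarith [ht.1]
    have e3 : 1 - t ^ 2 ≠ 0 := by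
      rw [show 1 - t ^ 2 = (1 - t) * (1 + t) by ring]; exact mul_ne_zero e1 e2
    simp only [logKernel, Real.log_neg_eq_log, sub_neg_eq_add, Real.log_pow]
    rw [abs_of_pos (by linarith [ht.1])]
    push_cast
    field_simp; ring
  rw [one_pow, e, intervalIntegral.integral_const_mul, intervalIntegral.integral_sub
    intervalIntegrable_logKernel_zero_one intervalIntegrable_logKernel_neg_zero_one,
    integral_logKernel_zero_one] at h
  linarith

theorem integral_logKernel_neg_one_zero :
    ∫ u in (-1 : ℝ)..0, logKernel u = 3 / 2 * zetaThree := by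
  rw [← integral_logKernel_neg_zero_one, intervalIntegral.integral_comp_neg, neg_zero]

theorem integral_logKernel_neg_one_one :
    ∫ u in (-1 : ℝ)..1, logKernel u = 7 / 2 * zetaThree := by
  rw [← intervalIntegral.integral_add_adjacent_intervals (b := 0)
    (intervalIntegrable_logKernel (by norm_num) (by norm_num))
    (intervalIntegrable_logKernel (by norm_num) (by norm_num)), integral_logKernel_neg_one_zero,
    integral_logKernel_zero_one]
  ring

theorem intervalIntegrable_logKernel_neg {a b : ℝ} (ha : a ∈ Set.Icc (-3 : ℝ) 3)
    (hb : b ∈ Set.Icc (-3 : ℝ) 3) : IntervalIntegrable (fun u => logKernel (-u)) volume a b := by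
  have := (IntervalIntegrable.iff_comp_neg (f := logKernel) (a := -a) (b := -b)).1
    (intervalIntegrable_logKernel ⟨by linarith [ha.2], by linarith [ha.1]⟩
      ⟨by linarith [hb.2], by linarith [hb.1]⟩)
  simpa using this

theorem intervalIntegrable_logKernel_even {a b : ℝ} (ha : a ∈ Set.Icc (-3 : ℝ) 3)
    (hb : b ∈ Set.Icc (-3 : ℝ) 3) :
    IntervalIntegrable (fun u => logKernel u + logKernel (-u)) volume a b :=
  (intervalIntegrable_logKernel ha hb).add (intervalIntegrable_logKernel_neg ha hb)

theorem integral_logKernel_even {a b : ℝ} (ha : a ∈ Set.Icc (-3 : ℝ) 3)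
    (hb : b ∈ Set.Icc (-3 : ℝ) 3) :
    ∫ u in a..b, (logKernel u + logKernel (-u))
      = (∫ u in a..b, logKernel u) + ∫ u in -b..-a, logKernel u := by
  rw [intervalIntegral.integral_add (intervalIntegrable_logKernel ha hb)
    (intervalIntegrable_logKernel_neg ha hb), intervalIntegral.integral_comp_neg]

/-! ### Substitutions and the relation between K(1, 3) and K(-3, -1) -/

theorem image_one_sub_div_one_add :
    (fun t : ℝ => (1 - t) / (1 + t)) '' Set.Ioo 0 2 = Set.Ioo (-(1 / 3)) 1 := by
  ext u
  constructor
  · rintro ⟨t, ⟨h0, h2⟩, rfl⟩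
    have : 0 < 1 + t := by linarith
    exact ⟨by rw [lt_div_iff₀ this]; linarith, by rw [div_lt_iff₀ this]; linarith⟩
  · rintro ⟨h0, h1⟩
    have : 0 < 1 + u := by linarith
    refine ⟨(1 - u) / (1 + u), ⟨div_pos (by linarith) this, ?_⟩, ?_⟩
    · rw [div_lt_iff₀ this]; linarith
    · field_simp; ring

theorem image_inv_Ioo : (fun t : ℝ => t⁻¹) '' Set.Ioo 1 3 = Set.Ioo (1 / 3) 1 := by
  ext u
  constructor
  · rintro ⟨t, ⟨h0, h2⟩, rfl⟩
    exact ⟨by rw [one_div]; exact inv_strictAnti₀ (by linarith) h2, inv_lt_one_of_one_lt₀ h0⟩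
  · rintro ⟨h0, h1⟩
    have hu : 0 < u := by linarith
    refine ⟨u⁻¹, ⟨(one_lt_inv₀ hu).2 h1, ?_⟩, inv_inv u⟩
    rw [inv_lt_comm₀ hu (by norm_num)]; linarith

/-- The form log² w dw / (1 - w²) is invariant under w ↦ 1/w, which reverses the orientation; hence
the sign. -/
theorem integral_logKernel_even_third_one :
    ∫ u in (1 / 3 : ℝ)..1, (logKernel u + logKernel (-u))
      = -∫ u in (1 : ℝ)..3, (logKernel u + logKernel (-u)) := by
  rw [(intervalIntegral_subst (φ := fun t => t⁻¹) (φ' := fun t => -(t ^ 2)⁻¹) (a := 1) (b := 3)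
    (by norm_num) (by norm_num) image_inv_Ioo
    (fun t ht => hasDerivAt_inv (by linarith [ht.1])) (fun x _ y _ h => inv_injective h)).2,
    ← intervalIntegral.integral_neg]
  refine intervalIntegral.integral_congr_Ioo_of_le (by norm_num) fun t ht => ?_
  have t0 : 0 < t := by linarith [ht.1]
  have ti : t⁻¹ < 1 := inv_lt_one_of_one_lt₀ ht.1
  have ti0 : 0 < t⁻¹ := inv_pos.2 t0
  have e : 1 - t ^ 2 ≠ 0 := by nlinarith [ht.1]
  have e' : t ^ 2 - 1 ≠ 0 := by nlinarith [ht.1]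
  rw [logKernel_even_part ti.ne (by linarith), logKernel_even_part ht.1.ne' (by linarith),
    abs_neg, abs_of_pos (by positivity), Real.log_inv]
  field_simp
  ring

/-- The integral over `(0, 2)` of `log² |(1 - t) / (1 + t)| / t`. -/
theorem integral_sq_log_div :
    IntervalIntegrable (fun t => Real.log ((1 - t) / (1 + t)) ^ 2 / t) volume 0 2 ∧
    ∫ t in (0 : ℝ)..2, Real.log ((1 - t) / (1 + t)) ^ 2 / t
      = 7 * zetaThree + (∫ u in (1 : ℝ)..3, logKernel u) + ∫ u in (-3 : ℝ)..(-1), logKernel u := by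
  have hs := intervalIntegral_subst (φ := fun t => (1 - t) / (1 + t))
    (φ' := fun t => -2 / (1 + t) ^ 2) (g := fun u => logKernel u + logKernel (-u))
    (a := 0) (b := 2) (by norm_num) (by norm_num) image_one_sub_div_one_add
    (fun t ht => ?_) (fun x hx y hy h => ?_)
  · have hc : Set.EqOn (fun t => |-2 / (1 + t) ^ 2| * (logKernel ((1 - t) / (1 + t))
          + logKernel (-((1 - t) / (1 + t)))))
        (fun t => Real.log ((1 - t) / (1 + t)) ^ 2 / t) (Set.Ioo 0 2) := fun t ht => by
      have p : 0 < 1 + t := by linarith [ht.1]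
      have t0 : t ≠ 0 := ht.1.ne'
      have h1 : (1 - t) / (1 + t) ≠ 1 := by
        rw [Ne, div_eq_iff p.ne']; intro h; exact t0 (by linarith)
      have h2 : (1 - t) / (1 + t) ≠ -1 := by
        rw [Ne, div_eq_iff p.ne']; intro h; linarith
      simp only
      rw [logKernel_even_part h1 h2, abs_div, abs_neg, abs_of_pos (by norm_num : (0 : ℝ) < 2),
        abs_of_pos (by positivity)]
      have h3 : 1 - ((1 - t) / (1 + t)) ^ 2 = 4 * t / (1 + t) ^ 2 := by field_simp; ring
      rw [h3]
      field_simp; ring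
    rw [intervalIntegral.integral_congr_Ioo_of_le (by norm_num) hc,
      intervalIntegrable_iff_integrableOn_Ioo_of_le (b := 2) (by norm_num),
      integrableOn_congr_fun hc measurableSet_Ioo,
      ← intervalIntegrable_iff_integrableOn_Ioo_of_le (by norm_num)] at hs
    refine ⟨hs.1.1 (intervalIntegrable_logKernel_even (by norm_num) (by norm_num)), ?_⟩
    -- The integral is K(-1/3, 1) + K(-1, 1/3), which is 2K(-1, 1) minus the even-part integral over
    -- (1/3, 1); inversion moves the latter to (1, 3).
    have h1 := integral_logKernel_even (a := -(1 / 3)) (b := 1) (by norm_num) (by norm_num)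
    have h2 := integral_logKernel_even (a := 1 / 3) (b := 1) (by norm_num) (by norm_num)
    have h3 := integral_logKernel_even (a := 1) (b := 3) (by norm_num) (by norm_num)
    have h4 := integral_logKernel_even_third_one
    have h5 := integral_logKernel_neg_one_one
    have h6 := intervalIntegral.integral_add_adjacent_intervals (f := logKernel) (μ := volume)
      (a := -1) (b := -(1 / 3)) (c := 1) (intervalIntegrable_logKernel (by norm_num) (by norm_num))
      (intervalIntegrable_logKernel (by norm_num) (by norm_num))
    have h7 := intervalIntegral.integral_add_adjacent_intervals (f := logKernel) (μ := volume)
      (a := -1) (b := 1 / 3) (c := 1) (intervalIntegrable_logKernel (by norm_num) (by norm_num))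
      (intervalIntegrable_logKernel (by norm_num) (by norm_num))
    rw [neg_neg] at h1
    linarith [hs.2]
  · have p : 1 + t ≠ 0 := by linarith [ht.1]
    convert! ((hasDerivAt_id t).const_sub 1).div ((hasDerivAt_id t).const_add 1) p using 1
    simp; ring
  · have p : 1 + x ≠ 0 := by linarith [hx.1]
    have q : 1 + y ≠ 0 := by linarith [hy.1]
    simp only at h
    rw [div_eq_div_iff p q] at h
    linarith

/-- With u = t² this is half the integral of log²|1 - u|/u over (0, 4), hence K(-3, 1)/2. -/
theorem integral_sq_log_one_sub_sq :
    IntervalIntegrable (fun t => Real.log (1 - t ^ 2) ^ 2 / t) volume 0 2 ∧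
    ∫ t in (0 : ℝ)..2, Real.log (1 - t ^ 2) ^ 2 / t
      = 1 / 2 * (7 / 2 * zetaThree + ∫ u in (-3 : ℝ)..(-1), logKernel u) := by
  have hs := integral_comp_sq (g := fun u => logKernel (1 - u)) (c := 2) two_pos
  have hc : Set.EqOn (fun t : ℝ => |2 * t| * logKernel (1 - t ^ 2))
      (fun t => 2 * (Real.log (1 - t ^ 2) ^ 2 / t)) (Set.Ioo 0 2) := fun t ht => by
    have := ht.1
    simp only [logKernel]
    rw [abs_of_pos (by linarith), sub_sub_cancel]
    field_simp
  rw [intervalIntegral.integral_congr_Ioo_of_le (by norm_num) hc,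
    intervalIntegrable_iff_integrableOn_Ioo_of_le (b := 2) (by norm_num),
    integrableOn_congr_fun hc measurableSet_Ioo,
    ← intervalIntegrable_iff_integrableOn_Ioo_of_le (by norm_num),
    intervalIntegral.integral_comp_sub_left, intervalIntegral.integral_const_mul] at hs
  have hi : IntervalIntegrable (fun u => logKernel (1 - u)) volume 0 (2 ^ 2) := by
    have := (intervalIntegrable_logKernel (a := 1) (b := -3) (by norm_num)
      (by norm_num)).comp_sub_left 1
    norm_num at this ⊢
    exact this
  refine ⟨?_, ?_⟩
  · have := (hs.1.1 hi).const_mul (1 / 2)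
    exact this.congr fun t _ => by ring
  · have h6 := intervalIntegral.integral_add_adjacent_intervals (f := logKernel) (μ := volume)
      (a := -3) (b := -1) (c := 1) (intervalIntegrable_logKernel (by norm_num) (by norm_num))
      (intervalIntegrable_logKernel (by norm_num) (by norm_num))
    have h5 := integral_logKernel_neg_one_one
    have h2 := hs.2
    norm_num at h2
    linarith

theorem intervalIntegrable_logKernel_one_sub {a b : ℝ} (ha : a ∈ Set.Icc (-2 : ℝ) 4)
    (hb : b ∈ Set.Icc (-2 : ℝ) 4) : IntervalIntegrable (fun t => logKernel (1 - t)) volume a b := by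
  have := (intervalIntegrable_logKernel (a := 1 - a) (b := 1 - b)
    ⟨by linarith [ha.2], by linarith [ha.1]⟩
    ⟨by linarith [hb.2], by linarith [hb.1]⟩).comp_sub_left 1
  simpa using this

theorem intervalIntegrable_logKernel_one_add {a b : ℝ} (ha : a ∈ Set.Icc (-4 : ℝ) 2)
    (hb : b ∈ Set.Icc (-4 : ℝ) 2) : IntervalIntegrable (fun t => logKernel (1 + t)) volume a b := by
  have := (intervalIntegrable_logKernel (a := 1 + a) (b := 1 + b)
    ⟨by linarith [ha.1], by linarith [ha.2]⟩
    ⟨by linarith [hb.1], by linarith [hb.2]⟩).comp_add_left 1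
  simpa using this

theorem integral_logKernel_one_sub : ∫ t in (0 : ℝ)..2, logKernel (1 - t) = 7 / 2 * zetaThree := by
  rw [intervalIntegral.integral_comp_sub_left, ← integral_logKernel_neg_one_one]
  norm_num

theorem integral_logKernel_one_add :
    ∫ t in (0 : ℝ)..2, logKernel (1 + t) = ∫ u in (1 : ℝ)..3, logKernel u := by
  rw [intervalIntegral.integral_comp_add_left]
  norm_num

theorem ae_ne_zero_one : ∀ᵐ t : ℝ, t ≠ 0 ∧ t ≠ 1 :=
  (Measure.ae_ne volume 0).and (Measure.ae_ne volume 1)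

/-- The parallelogram identity for `log |1 - t|` and `log (1 + t)`, integrated against `dt / t`. -/
theorem integral_logKernel_relation :
    (∫ u in (1 : ℝ)..3, logKernel u) + 1 / 2 * ∫ u in (-3 : ℝ)..(-1), logKernel u
      = -(7 / 12) * zetaThree := by
  have h : ∫ t in (0 : ℝ)..2, (Real.log ((1 - t) / (1 + t)) ^ 2 / t + Real.log (1 - t ^ 2) ^ 2 / t)
      = ∫ t in (0 : ℝ)..2, (2 * logKernel (1 - t) - 2 * logKernel (1 + t)) := by
    refine intervalIntegral.integral_congr_ae ?_
    filter_upwards [ae_ne_zero_one] with t ht hm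
    rw [Set.uIoc_of_le (by norm_num)] at hm
    have p : 1 + t ≠ 0 := by linarith [hm.1]
    have q : 1 - t ≠ 0 := sub_ne_zero.2 ht.2.symm
    have := ht.1
    rw [show 1 - t ^ 2 = (1 - t) * (1 + t) by ring, Real.log_mul q p, Real.log_div q p,
      logKernel, logKernel, show 1 - (1 + t) = -t by ring, show 1 - (1 - t) = t by ring]
    field_simp; ring
  rw [intervalIntegral.integral_add integral_sq_log_div.1 integral_sq_log_one_sub_sq.1,
    intervalIntegral.integral_sub
      ((intervalIntegrable_logKernel_one_sub (by norm_num) (by norm_num)).const_mul 2)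
      ((intervalIntegrable_logKernel_one_add (by norm_num) (by norm_num)).const_mul 2),
    intervalIntegral.integral_const_mul, intervalIntegral.integral_const_mul,
    integral_sq_log_div.2, integral_sq_log_one_sub_sq.2, integral_logKernel_one_sub,
    integral_logKernel_one_add] at h
  -- The equation reads 7ζ(3) + K(1, 3) + K(-3, -1) + (7/2 ζ(3) + K(-3, -1))/2 = 7ζ(3) - 2K(1, 3).
  linarith

/-- With α = log|1 - t| and β = log(1 + t), α(α - β) = ((α - β)² + α² - β²)/2; K(1, 3) and K(-3, -1)
then occur only in the combination already evaluated. -/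
theorem integral_log_mul_log_div :
    IntervalIntegrable (fun t => Real.log (1 - t) * (Real.log (1 - t) - Real.log (1 + t)) / t)
      volume 0 2 ∧
    ∫ t in (0 : ℝ)..2, Real.log (1 - t) * (Real.log (1 - t) - Real.log (1 + t)) / t
      = 14 / 3 * zetaThree := by
  have i1 := intervalIntegrable_logKernel_one_sub (a := 0) (b := 2) (by norm_num) (by norm_num)
  have i2 := intervalIntegrable_logKernel_one_add (a := 0) (b := 2) (by norm_num) (by norm_num)
  have i3 := (integral_sq_log_div.1.add (i1.add i2)).const_mul (1 / 2)
  have hc : ∀ᵐ t : ℝ, t ∈ Set.uIoc 0 2 →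
      1 / 2 * (Real.log ((1 - t) / (1 + t)) ^ 2 / t + (logKernel (1 - t) + logKernel (1 + t)))
        = Real.log (1 - t) * (Real.log (1 - t) - Real.log (1 + t)) / t := by
    filter_upwards [ae_ne_zero_one] with t ht hm
    rw [Set.uIoc_of_le (by norm_num)] at hm
    have p : 1 + t ≠ 0 := by linarith [hm.1]
    have q : 1 - t ≠ 0 := sub_ne_zero.2 ht.2.symm
    have := ht.1
    rw [Real.log_div q p, logKernel, logKernel, show 1 - (1 + t) = -t by ring,
      show 1 - (1 - t) = t by ring]
    field_simp; ring
  refine ⟨i3.congr_ae ?_, ?_⟩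
  · exact (ae_restrict_iff' measurableSet_uIoc).2 hc
  · rw [← intervalIntegral.integral_congr_ae hc, intervalIntegral.integral_const_mul,
      intervalIntegral.integral_add integral_sq_log_div.1 (i1.add i2),
      intervalIntegral.integral_add i1 i2, integral_sq_log_div.2, integral_logKernel_one_sub,
      integral_logKernel_one_add]
    linarith [integral_logKernel_relation]

/-! ### Polylogarithms along the two real rays -/

/-- The derivative of the dilogarithm along the ray of direction `σ`. -/
noncomputable def dilogDeriv (σ s : ℝ) : ℂ := -Complex.log (1 - (σ * s : ℝ)) / s

theorem dilogDeriv_re (σ s : ℝ) : (dilogDeriv σ s).re = -Real.log (1 - σ * s) / s := by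
  rw [dilogDeriv, Complex.div_ofReal_re, Complex.neg_re, Complex.log_re,
    show (1 : ℂ) - (σ * s : ℝ) = ((1 - σ * s : ℝ) : ℂ) by push_cast; ring, Complex.norm_real,
    Real.norm_eq_abs, Real.log_abs]

theorem measurable_dilogDeriv (σ : ℝ) : Measurable (dilogDeriv σ) := by
  unfold dilogDeriv; fun_prop

theorem norm_dilogDeriv_le_of_le {σ s : ℝ} (hσ : |σ| = 1) (h0 : 0 < s) (h1 : s ≤ 1 / 2) :
    ‖dilogDeriv σ s‖ ≤ 2 := by
  have hn : ‖(-(σ * s : ℝ) : ℂ)‖ = s := by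
    rw [norm_neg, Complex.norm_real, Real.norm_eq_abs, abs_mul, hσ, one_mul, abs_of_pos h0]
  have := Complex.norm_log_one_add_half_le_self (z := (-(σ * s : ℝ) : ℂ)) (by rw [hn]; exact h1)
  rw [hn, ← sub_eq_add_neg] at this
  rw [dilogDeriv, norm_div, norm_neg, Complex.norm_real, Real.norm_of_nonneg h0.le,
    div_le_iff₀ h0]
  linarith

/-- The imaginary part of the principal logarithm costs π, division by s ≥ 1/2 a factor 2, and the
last summand covers s ≤ 1/2. -/
theorem norm_dilogDeriv_le {σ s : ℝ} (hσ : |σ| = 1) (h0 : 0 < s) :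
    ‖dilogDeriv σ s‖ ≤ 2 * (|Real.log (1 - σ * s)| + Real.pi) + 2 := by
  have hp := Real.pi_pos
  rcases le_total s (1 / 2) with h | h
  · have := norm_dilogDeriv_le_of_le hσ h0 h
    have := abs_nonneg (Real.log (1 - σ * s))
    linarith
  · have h1 : ‖Complex.log (1 - (σ * s : ℝ))‖ ≤ |Real.log (1 - σ * s)| + Real.pi := by
      refine (Complex.norm_le_abs_re_add_abs_im _).trans ?_
      rw [Complex.log_re, Complex.log_im]
      refine add_le_add (le_of_eq ?_) (Complex.abs_arg_le_pi _)
      rw [show (1 : ℂ) - (σ * s : ℝ) = ((1 - σ * s : ℝ) : ℂ) by push_cast; ring,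
        Complex.norm_real, Real.norm_eq_abs, Real.log_abs]
    rw [dilogDeriv, norm_div, norm_neg, Complex.norm_real, Real.norm_of_nonneg h0.le,
      div_le_iff₀ h0]
    have := norm_nonneg (Complex.log (1 - (σ * s : ℝ)))
    nlinarith

theorem intervalIntegrable_log_one_sub_mul {σ : ℝ} (hσ : |σ| = 1) (a b : ℝ) :
    IntervalIntegrable (fun s => Real.log (1 - σ * s)) volume a b := by
  have hs : σ ≠ 0 := fun h => by simp [h] at hσ
  have h1 : IntervalIntegrable (fun u => Real.log (1 - u)) volume (σ * a) (σ * b) := by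
    have := (intervalIntegral.intervalIntegrable_log' (a := 1 - σ * a)
      (b := 1 - σ * b)).comp_sub_left 1
    simpa using this
  have := h1.comp_mul_left (c := σ)
  simpa [hs] using this

theorem intervalIntegrable_dilogDeriv {σ : ℝ} (hσ : |σ| = 1) {a b : ℝ} (ha : 0 ≤ a) (hb : 0 ≤ b) :
    IntervalIntegrable (dilogDeriv σ) volume a b := by
  have h := ((((intervalIntegrable_log_one_sub_mul hσ a b).abs).add
    (intervalIntegrable_const (c := Real.pi))).const_mul 2).add
    (intervalIntegrable_const (c := (2 : ℝ)))
  refine h.mono_fun' (measurable_dilogDeriv σ).aestronglyMeasurable ?_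
  filter_upwards [ae_restrict_mem measurableSet_uIoc] with s hs
  exact norm_dilogDeriv_le hσ (lt_of_le_of_lt (le_min ha hb) hs.1)

/-- Rescaling the defining segment by x exhibits Li₂ as a primitive in the radial variable; σ = ±1
gives the two half-lines. -/
theorem polylog_two_eq {σ x : ℝ} (hx : 0 ≤ x) :
    polylog 2 ((σ * x : ℝ) : ℂ) = ∫ s in (0 : ℝ)..x, dilogDeriv σ s := by
  rcases hx.eq_or_lt with rfl | hx
  · simp [polylog]
  have := intervalIntegral.smul_integral_comp_mul_left (a := 0) (b := 1) (dilogDeriv σ) x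
  rw [mul_zero, mul_one] at this
  rw [← this, polylog, ← intervalIntegral.integral_smul]
  refine intervalIntegral.integral_congr fun t _ => ?_
  have hx' : (x : ℂ) ≠ 0 := by exact_mod_cast hx.ne'
  simp only [polylog, dilogDeriv, Complex.real_smul]
  push_cast
  rcases eq_or_ne t 0 with rfl | ht
  · simp
  have ht' : (t : ℂ) ≠ 0 := by exact_mod_cast ht
  field_simp

theorem polylog_three_eq {σ x : ℝ} (hx : 0 < x) :
    polylog 3 ((σ * x : ℝ) : ℂ) = ∫ s in (0 : ℝ)..x, polylog 2 ((σ * s : ℝ) : ℂ) / s := by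
  have := intervalIntegral.smul_integral_comp_mul_left (a := 0) (b := 1)
    (fun s : ℝ => polylog 2 ((σ * s : ℝ) : ℂ) / s) x
  rw [mul_zero, mul_one] at this
  rw [← this, polylog, ← intervalIntegral.integral_smul]
  refine intervalIntegral.integral_congr fun t _ => ?_
  have hx' : (x : ℂ) ≠ 0 := by exact_mod_cast hx.ne'
  simp only [Complex.real_smul]
  push_cast
  rw [show (t : ℂ) * (σ * x) = σ * (x * t) by ring]
  rcases eq_or_ne t 0 with rfl | ht
  · simp
  have ht' : (t : ℂ) ≠ 0 := by exact_mod_cast ht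
  field_simp

theorem continuousOn_polylog_two {σ : ℝ} (hσ : |σ| = 1) {X : ℝ} (hX : 0 ≤ X) :
    ContinuousOn (fun s : ℝ => polylog 2 ((σ * s : ℝ) : ℂ)) (Set.Icc 0 X) := by
  have h := intervalIntegral.continuousOn_primitive_interval (μ := volume) (a := 0) (b := X)
    (f := dilogDeriv σ) (by
      rw [Set.uIcc_of_le hX, integrableOn_Icc_iff_integrableOn_Ioc]
      exact (intervalIntegrable_iff_integrableOn_Ioc_of_le hX).1
        (intervalIntegrable_dilogDeriv hσ le_rfl hX))
  rw [Set.uIcc_of_le hX] at h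
  exact h.congr fun s hs => polylog_two_eq hs.1

/-- Makes Li₂(σs)/s bounded and log s · Li₂(σs) infinitesimal at 0. -/
theorem norm_polylog_two_le {σ s : ℝ} (hσ : |σ| = 1) (h0 : 0 ≤ s) (h1 : s ≤ 1 / 2) :
    ‖polylog 2 ((σ * s : ℝ) : ℂ)‖ ≤ 2 * s := by
  rw [polylog_two_eq h0]
  refine (intervalIntegral.norm_integral_le_of_norm_le_const (C := 2) fun t ht => ?_).trans ?_
  · rw [Set.uIoc_of_le h0] at ht
    exact norm_dilogDeriv_le_of_le hσ ht.1 (ht.2.trans h1)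
  · rw [sub_zero, abs_of_nonneg h0]

theorem intervalIntegrable_polylog_two_div {σ : ℝ} (hσ : |σ| = 1) {X : ℝ} (hX : 0 < X) :
    IntervalIntegrable (fun s : ℝ => polylog 2 ((σ * s : ℝ) : ℂ) / s) volume 0 X := by
  obtain ⟨M, hM⟩ := (isCompact_Icc (a := (0 : ℝ)) (b := X)).exists_bound_of_continuousOn
    (continuousOn_polylog_two hσ hX.le)
  rw [intervalIntegrable_iff_integrableOn_Ioo_of_le hX.le]
  have hc : ContinuousOn (fun s : ℝ => polylog 2 ((σ * s : ℝ) : ℂ) / s) (Set.Ioo 0 X) := by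
    refine ((continuousOn_polylog_two hσ hX.le).mono Set.Ioo_subset_Icc_self).div
      (by fun_prop) fun s hs => ?_
    exact_mod_cast hs.1.ne'
  refine Integrable.mono' (integrable_const (2 * M + 2))
    (hc.aestronglyMeasurable measurableSet_Ioo) ?_
  filter_upwards [ae_restrict_mem measurableSet_Ioo] with s hs
  have h1 := hM s ⟨hs.1.le, hs.2.le⟩
  have h0 := norm_nonneg (polylog 2 ((σ * s : ℝ) : ℂ))
  rw [norm_div, Complex.norm_real, Real.norm_of_nonneg hs.1.le, div_le_iff₀ hs.1]
  rcases le_total s (1 / 2) with h | h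
  · have := norm_polylog_two_le hσ hs.1.le h
    nlinarith [hs.1]
  · nlinarith

/-- The real part of the dilogarithm along a ray. -/
noncomputable def dilogRe (σ x : ℝ) : ℝ := (polylog 2 ((σ * x : ℝ) : ℂ)).re

theorem dilogRe_div (σ s : ℝ) : dilogRe σ s / s = (polylog 2 ((σ * s : ℝ) : ℂ) / s).re := by
  rw [Complex.div_ofReal_re, dilogRe]

theorem intervalIntegrable_dilogRe_div {σ x : ℝ} (hσ : |σ| = 1) (hx : 0 < x) :
    IntervalIntegrable (fun s => dilogRe σ s / s) volume 0 x := by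
  simp_rw [dilogRe_div]
  have := (intervalIntegrable_iff.1 (intervalIntegrable_polylog_two_div hσ hx)).re
  exact intervalIntegrable_iff.2 this

theorem polylog_three_re {σ x : ℝ} (hσ : |σ| = 1) (hx : 0 < x) :
    (polylog 3 ((σ * x : ℝ) : ℂ)).re = ∫ s in (0 : ℝ)..x, dilogRe σ s / s := by
  rw [polylog_three_eq hx]
  simp_rw [dilogRe_div]
  exact (intervalIntegral.intervalIntegral_re (intervalIntegrable_polylog_two_div hσ hx)).symm

theorem dilogRe_eq {σ x : ℝ} (hσ : |σ| = 1) (hx : 0 ≤ x) :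
    dilogRe σ x = ∫ s in (0 : ℝ)..x, -Real.log (1 - σ * s) / s := by
  rw [dilogRe, polylog_two_eq hx]
  simp_rw [← dilogDeriv_re]
  exact (intervalIntegral.intervalIntegral_re (intervalIntegrable_dilogDeriv hσ le_rfl hx)).symm

theorem hasDerivAt_dilogRe {σ x : ℝ} (hσ : |σ| = 1) (hx : 0 < x) (h : σ * x ≠ 1) :
    HasDerivAt (dilogRe σ) (-Real.log (1 - σ * x) / x) x := by
  have he : dilogRe σ =ᶠ[nhds x] fun y => ∫ s in (0 : ℝ)..y, -Real.log (1 - σ * s) / s := by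
    filter_upwards [lt_mem_nhds hx] with y hy
    exact dilogRe_eq hσ hy.le
  refine HasDerivAt.congr_of_eventuallyEq ?_ he
  have hm : Measurable fun s => -Real.log (1 - σ * s) / s := by fun_prop
  refine intervalIntegral.integral_hasDerivAt_right ?_
    (hm.stronglyMeasurable.stronglyMeasurableAtFilter) ?_
  · simp_rw [← dilogDeriv_re]
    exact intervalIntegrable_iff.2
      (intervalIntegrable_iff.1 (intervalIntegrable_dilogDeriv hσ le_rfl hx.le)).re
  · have h1 : 1 - σ * x ≠ 0 := sub_ne_zero.2 h.symm
    have h2 : x ≠ 0 := hx.ne'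
    exact ContinuousAt.div (by fun_prop (disch := assumption)) (by fun_prop) h2

theorem continuousOn_dilogRe {σ : ℝ} (hσ : |σ| = 1) {X : ℝ} (hX : 0 ≤ X) :
    ContinuousOn (dilogRe σ) (Set.Icc 0 X) :=
  Complex.continuous_re.comp_continuousOn (continuousOn_polylog_two hσ hX)

/-- Only σ = 1, t = 1 is delicate: there log² t vanishes to second order and absorbs the singularity
of log(1 - t). -/
theorem continuousAt_log_sq_mul_log {σ t : ℝ} (hσ : |σ| = 1) (ht : 0 < t) :
    ContinuousAt (fun t => Real.log t ^ 2 * Real.log (1 - σ * t)) t := by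
  rcases eq_or_ne (σ * t) 1 with h | h
  · have t1 : t = 1 := by
      have := congrArg abs h
      rwa [abs_mul, hσ, one_mul, abs_one, abs_of_pos ht] at this
    subst t1
    obtain rfl : σ = 1 := by simpa using h
    have e : (fun t => Real.log t ^ 2 * Real.log (1 - 1 * t)) = fun t =>
        dslope Real.log 1 t ^ 2 * (-(t - 1)) * ((1 - t) * Real.log (1 - t)) := by
      funext t
      have := sub_smul_dslope Real.log 1 t
      rw [Real.log_one, sub_zero, smul_eq_mul] at this
      rw [← this]
      ring_nf
    rw [e]
    have h1 : ContinuousAt (dslope Real.log 1) 1 :=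
      continuousAt_dslope_same.2 (Real.differentiableAt_log one_ne_zero)
    have h2 : Continuous fun t : ℝ => (1 - t) * Real.log (1 - t) :=
      Real.continuous_mul_log.comp (by fun_prop : Continuous fun t : ℝ => 1 - t)
    exact ((h1.pow 2).mul (by fun_prop)).mul h2.continuousAt
  · have h1 : 1 - σ * t ≠ 0 := sub_ne_zero.2 h.symm
    have h2 : t ≠ 0 := ht.ne'
    fun_prop (disch := assumption)

/-- The second logarithm vanishes at 0 to first order, and t log² t = 4(√t log √t)² tends to 0. -/
theorem tendsto_log_sq_mul_log (σ : ℝ) :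
    ContinuousWithinAt (fun t => Real.log t ^ 2 * Real.log (1 - σ * t)) (Set.Ici 0) 0 := by
  have hd : DifferentiableAt ℝ (fun t => Real.log (1 - σ * t)) 0 := by
    refine DifferentiableAt.log (by fun_prop) (by simp)
  have h1 : ContinuousAt (dslope (fun t => Real.log (1 - σ * t)) 0) 0 :=
    continuousAt_dslope_same.2 hd
  have h2 : Continuous fun t : ℝ => 4 * (√t * Real.log √t) ^ 2 := by
    have := Real.continuous_mul_log.comp Real.continuous_sqrt
    exact (this.pow 2).const_mul 4 |>.congr fun t => rfl
  refine (h2.continuousAt.mul h1).continuousWithinAt.congr (fun t ht => ?_) (by simp)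
  have := sub_smul_dslope (fun t => Real.log (1 - σ * t)) 0 t
  simp only [mul_zero, sub_zero, Real.log_one, smul_eq_mul] at this
  have ht' : 0 ≤ t := ht
  simp only [Pi.mul_apply]
  rw [← this, Real.log_sqrt ht', mul_pow, Real.sq_sqrt ht']
  ring

/-- Integration by parts for the real part of the trilogarithm. -/
theorem polylog_three_re_eq {σ x : ℝ} (hσ : |σ| = 1) (hx : 0 < x)
    (hi : IntervalIntegrable (fun t => logKernel (σ * t)) volume 0 x) :
    (polylog 3 ((σ * x : ℝ) : ℂ)).re = Real.log x * dilogRe σ x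
      + 1 / 2 * (Real.log x ^ 2 * Real.log (1 - σ * x))
      + σ / 2 * ∫ t in (0 : ℝ)..x, logKernel (σ * t) := by
  have hi2 := hi.const_mul (σ / 2)
  -- In the derivative of this function the terms in log t · log(1 - σt)/t cancel. The point 1 is
  -- excluded because log(1 - σt) is singular there when σ = 1.
  have hF := integral_eq_of_hasDerivAt_off_countable_of_le
    (fun t => Real.log t * dilogRe σ t + 1 / 2 * (Real.log t ^ 2 * Real.log (1 - σ * t)))
    (fun t => dilogRe σ t / t - σ / 2 * logKernel (σ * t)) hx.le (s := {1})
    (Set.countable_singleton 1) (fun t ht => ?_) (fun t ht => ?_)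
    ((intervalIntegrable_dilogRe_div hσ hx).sub hi2)
  · rw [intervalIntegral.integral_sub (intervalIntegrable_dilogRe_div hσ hx) hi2,
      intervalIntegral.integral_const_mul, ← polylog_three_re hσ hx] at hF
    simp only [Real.log_zero, zero_mul] at hF
    linarith
  · rcases ht.1.eq_or_lt with rfl | h0
    · refine ContinuousWithinAt.add ?_ (((tendsto_log_sq_mul_log σ).mono
        (fun t ht => ht.1)).const_mul _)
      have hz : dilogRe σ 0 = 0 := by simp [dilogRe, polylog]
      rw [ContinuousWithinAt, Real.log_zero, zero_mul]
      have h1 : Filter.Tendsto (fun t : ℝ => 2 * |t * Real.log t|) (nhdsWithin 0 (Set.Icc 0 x))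
          (nhds 0) := by
        have h := (Real.continuous_mul_log.abs.const_mul 2).tendsto 0
        simp only [Real.log_zero, mul_zero, abs_zero] at h
        exact h.mono_left nhdsWithin_le_nhds
      refine squeeze_zero_norm' ?_ h1
      filter_upwards [self_mem_nhdsWithin, nhdsWithin_le_nhds
        (gt_mem_nhds (by norm_num : (0 : ℝ) < 1 / 2))] with t ht ht2
      have h2 : |dilogRe σ t| ≤ 2 * t :=
        (Complex.abs_re_le_norm _).trans (norm_polylog_two_le hσ ht.1 ht2.le)
      rw [Real.norm_eq_abs, abs_mul, abs_mul, abs_of_nonneg ht.1]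
      nlinarith [abs_nonneg (Real.log t)]
    · exact (((Real.continuousAt_log h0.ne').continuousWithinAt).mul
        (continuousOn_dilogRe hσ hx.le t ht)).add
        ((continuousAt_log_sq_mul_log hσ h0).const_mul _).continuousWithinAt
  · have h0 : 0 < t := ht.1.1
    have h1 : σ * t ≠ 1 := fun h => ht.2 (by
      have := congrArg abs h
      rwa [abs_mul, hσ, one_mul, abs_one, abs_of_pos h0] at this)
    have h2 : 1 - σ * t ≠ 0 := sub_ne_zero.2 h1.symm
    have d1 := Real.hasDerivAt_log h0.ne'
    have d2 := hasDerivAt_dilogRe hσ h0 h1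
    have d3 := (((hasDerivAt_id t).const_mul σ).const_sub 1).log h2
    have hl : Real.log (σ * t) = Real.log t := by
      rw [← Real.log_abs, abs_mul, hσ, one_mul, Real.log_abs]
    refine ((d1.mul d2).add (((d1.pow 2).mul d3).const_mul (1 / 2))).congr_deriv ?_
    rw [logKernel, hl]
    simp only [id, Pi.pow_apply]
    field_simp
    ring

/-- The coefficients 2^j B_j / j! for j = 0, 1, 2 are 1, -1, 1/3. -/
theorem zagierL_three (x : ℂ) : zagierL 3 x = (polylog 3 x).re
    - Real.log ‖x‖ * (polylog 2 x).re + 1 / 3 * Real.log ‖x‖ ^ 2 * (polylog 1 x).re := by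
  have h3 : Odd 3 := by decide
  have key : ∑ j ∈ Finset.range 3, (2 : ℂ) ^ j * (bernoulli j : ℂ) / (Nat.factorial j : ℂ)
      * (Real.log ‖x‖ : ℂ) ^ j * polylog (3 - j) x = polylog 3 x
      + ((-Real.log ‖x‖ : ℝ) : ℂ) * polylog 2 x
      + ((1 / 3 * Real.log ‖x‖ ^ 2 : ℝ) : ℂ) * polylog 1 x := by
    simp only [Finset.sum_range_succ, Finset.sum_range_zero, bernoulli_zero, bernoulli_one,
      bernoulli_two, Nat.factorial]
    push_cast
    ring
  simp only [zagierL, h3, if_true]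
  rw [key, Complex.add_re, Complex.add_re, Complex.re_ofReal_mul, Complex.re_ofReal_mul]
  ring

/-- The dilogarithms cancel, and the elementary terms combine with coefficient 1/2 - 1/3. -/
theorem zagierL_three_eq {σ x : ℝ} (hσ : |σ| = 1) (hx : 0 < x)
    (hi : IntervalIntegrable (fun t => logKernel (σ * t)) volume 0 x) :
    zagierL 3 ((σ * x : ℝ) : ℂ) = 1 / 6 * (Real.log x ^ 2 * Real.log (1 - σ * x))
      + σ / 2 * ∫ t in (0 : ℝ)..x, logKernel (σ * t) := by
  have hn : ‖((σ * x : ℝ) : ℂ)‖ = x := by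
    rw [Complex.norm_real, Real.norm_eq_abs, abs_mul, hσ, one_mul, abs_of_pos hx]
  have h1 : (polylog 1 ((σ * x : ℝ) : ℂ)).re = -Real.log (1 - σ * x) := by
    rw [polylog, Complex.neg_re, Complex.log_re,
      show (1 : ℂ) - (σ * x : ℝ) = ((1 - σ * x : ℝ) : ℂ) by push_cast; ring, Complex.norm_real,
      Real.norm_eq_abs, Real.log_abs]
  rw [zagierL_three, hn, h1, polylog_three_re_eq hσ hx hi, dilogRe]
  ring

theorem zagierL_three_pos {x : ℝ} (hx : 0 < x) (hx3 : x ≤ 3) :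
    zagierL 3 x = 1 / 6 * (Real.log x ^ 2 * Real.log (1 - x))
      + 1 / 2 * ∫ t in (0 : ℝ)..x, logKernel t := by
  have := zagierL_three_eq (σ := 1) (by simp) hx (by
    simpa using intervalIntegrable_logKernel (by norm_num) ⟨by linarith, hx3⟩)
  simpa using this

theorem zagierL_three_neg {x : ℝ} (hx : 0 < x) (hx3 : x ≤ 3) :
    zagierL 3 (-x : ℝ) = 1 / 6 * (Real.log x ^ 2 * Real.log (1 + x))
      - 1 / 2 * ∫ u in (-x)..0, logKernel u := by
  have := zagierL_three_eq (σ := -1) (by simp) hx (by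
    simpa using intervalIntegrable_logKernel_neg (by norm_num) ⟨by linarith, hx3⟩)
  simp only [neg_mul, one_mul, sub_neg_eq_add] at this
  rw [this, intervalIntegral.integral_comp_neg, neg_zero]
  ring

/-- At 1 the elementary term is 0 through its factor log² x, which is also its limit; so the formula
gives the value by continuity. -/
theorem zagierL_three_one : zagierL 3 1 = zetaThree := by
  have := zagierL_three_pos one_pos (by norm_num)
  rw [integral_logKernel_zero_one] at this
  simpa using this

theorem zagierL_three_neg_one : zagierL 3 (-1) = -(3 / 4) * zetaThree := by
  have := zagierL_three_neg one_pos (by norm_num)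
  rw [integral_logKernel_neg_one_zero] at this
  norm_num at this
  rw [this]; ring

theorem zagierL_three_relation :
    2 * zagierL 3 3 - zagierL 3 (-3) = 13 / 6 * zetaThree := by
  have h1 := zagierL_three_pos (x := 3) (by norm_num) le_rfl
  have h2 := zagierL_three_neg (x := 3) (by norm_num) le_rfl
  have i : ∀ {a b : ℝ}, a ∈ Set.Icc (-3 : ℝ) 3 → b ∈ Set.Icc (-3 : ℝ) 3 →
    IntervalIntegrable logKernel volume a b := fun ha hb => intervalIntegrable_logKernel ha hb
  rw [← intervalIntegral.integral_add_adjacent_intervals (b := 1) (i (by norm_num) (by norm_num))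
    (i (by norm_num) (by norm_num)), integral_logKernel_zero_one] at h1
  rw [← intervalIntegral.integral_add_adjacent_intervals (b := -1) (i (by norm_num) (by norm_num))
    (i (by norm_num) (by norm_num)), integral_logKernel_neg_one_zero] at h2
  -- log|1 - 3| is half of log(1 + 3), so the elementary terms cancel.
  have l1 : Real.log (1 - 3) = Real.log 2 := by
    rw [← Real.log_abs]; norm_num
  have l2 : Real.log (1 + 3) = 2 * Real.log 2 := by
    rw [show (1 : ℝ) + 3 = 2 ^ 2 by norm_num, Real.log_pow]; norm_num
  rw [l1] at h1
  rw [l2] at h2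
  push_cast at h1 h2
  rw [h1, h2]
  linarith [integral_logKernel_relation]

/-! ### The integral of log|1 + x + y| over two upper half circles -/

/-- Both sines are nonnegative, so a zero would have both exponentials equal to ±1, and 1 ± 1 ± 1 is
odd. -/
theorem one_add_exp_add_exp_ne_zero {a b : ℝ} (ha : a ∈ Set.Icc 0 Real.pi)
    (hb : b ∈ Set.Icc 0 Real.pi) :
    1 + Complex.exp (a * Complex.I) + Complex.exp (b * Complex.I) ≠ 0 := by
  intro h
  have h1 := congrArg Complex.im h
  have h2 := congrArg Complex.re h
  simp only [Complex.add_im, Complex.add_re, Complex.one_im, Complex.one_re,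
    Complex.exp_ofReal_mul_I_re, Complex.exp_ofReal_mul_I_im, Complex.zero_im,
    Complex.zero_re] at h1 h2
  have sa := Real.sin_nonneg_of_mem_Icc ha
  have sb := Real.sin_nonneg_of_mem_Icc hb
  have sa0 : Real.sin a = 0 := by linarith
  have sb0 : Real.sin b = 0 := by linarith
  have ca := Real.sin_sq_add_cos_sq a
  have cb := Real.sin_sq_add_cos_sq b
  rw [sa0] at ca
  rw [sb0] at cb
  have ca' : Real.cos a = 1 ∨ Real.cos a = -1 := mul_self_eq_one_iff.1 (by linarith)
  have cb' : Real.cos b = 1 ∨ Real.cos b = -1 := mul_self_eq_one_iff.1 (by linarith)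
  rcases ca' with h | h <;> rcases cb' with h' | h' <;> rw [h, h'] at h2 <;> norm_num at h2

theorem one_add_exp_add_exp_mem_slitPlane {a b : ℝ} (ha : a ∈ Set.Icc 0 Real.pi)
    (hb : b ∈ Set.Ioo 0 Real.pi) :
    1 + Complex.exp (a * Complex.I) + Complex.exp (b * Complex.I) ∈ Complex.slitPlane := by
  refine Or.inr (ne_of_gt ?_)
  simp only [Complex.add_im, Complex.one_im, Complex.exp_ofReal_mul_I_im]
  linarith [Real.sin_nonneg_of_mem_Icc ha, Real.sin_pos_of_mem_Ioo hb]

theorem hasDerivAt_exp_mul_I (b : ℝ) : HasDerivAt (fun b : ℝ => Complex.exp (b * Complex.I))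
    (Complex.exp (b * Complex.I) * Complex.I) b := by
  have := ((hasDerivAt_id (b : ℂ)).mul_const Complex.I).cexp.comp_ofReal
  simpa using this

/-- The logarithmic derivative in `b` of `1 + exp (ia) + exp (ib)`. -/
noncomputable def arcLogDeriv (a b : ℝ) : ℂ :=
  Complex.exp (b * Complex.I) * Complex.I /
    (1 + Complex.exp (a * Complex.I) + Complex.exp (b * Complex.I))

theorem continuousOn_arcLogDeriv : ContinuousOn (fun p : ℝ × ℝ => arcLogDeriv p.1 p.2)
    (Set.Icc 0 Real.pi ×ˢ Set.Icc 0 Real.pi) := by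
  unfold arcLogDeriv
  refine ContinuousOn.div (by fun_prop) (by fun_prop) fun p hp => ?_
  exact one_add_exp_add_exp_ne_zero hp.1 hp.2

theorem continuousOn_log_arc : ContinuousOn (fun p : ℝ × ℝ =>
      Real.log ‖1 + Complex.exp (p.1 * Complex.I) + Complex.exp (p.2 * Complex.I)‖)
    (Set.Icc 0 Real.pi ×ˢ Set.Icc 0 Real.pi) := by
  refine ContinuousOn.log (by fun_prop) fun p hp => ?_
  exact norm_ne_zero_iff.2 (one_add_exp_add_exp_ne_zero hp.1 hp.2)

/-- Integration by parts with primitive b of 1: the boundary term vanishes at 0 by the factor b, and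
at π because |1 + e^(ia) - 1| = 1. -/
theorem integral_log_arc {a : ℝ} (ha : a ∈ Set.Icc 0 Real.pi) :
    ∫ b in (0 : ℝ)..Real.pi, Real.log ‖1 + Complex.exp (a * Complex.I) +
      Complex.exp (b * Complex.I)‖ = -∫ b in (0 : ℝ)..Real.pi, b * (arcLogDeriv a b).re := by
  have c1 : ContinuousOn (fun b : ℝ => Real.log ‖1 + Complex.exp (a * Complex.I) +
      Complex.exp (b * Complex.I)‖) (Set.Icc 0 Real.pi) :=
    continuousOn_log_arc.comp (f := fun b : ℝ => (a, b)) (by fun_prop) fun b hb => ⟨ha, hb⟩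
  have c2 : ContinuousOn (fun b : ℝ => b * (arcLogDeriv a b).re) (Set.Icc 0 Real.pi) :=
    continuousOn_id.mul (Complex.continuous_re.comp_continuousOn
      (continuousOn_arcLogDeriv.comp (f := fun b : ℝ => (a, b)) (by fun_prop) fun b hb => ⟨ha, hb⟩))
  have i1 := c1.intervalIntegrable_of_Icc (μ := volume) Real.pi_pos.le
  have i2 := c2.intervalIntegrable_of_Icc (μ := volume) Real.pi_pos.le
  have h := intervalIntegral.integral_eq_sub_of_hasDerivAt_of_le Real.pi_pos.le
    (continuousOn_id.mul c1) (f' := fun b : ℝ => Real.log ‖1 + Complex.exp (a * Complex.I) +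
      Complex.exp (b * Complex.I)‖ + b * (arcLogDeriv a b).re) (fun b hb => ?_) (i1.add i2)
  · rw [intervalIntegral.integral_add i1 i2] at h
    simp only [Pi.mul_apply, id, zero_mul, Complex.exp_pi_mul_I, add_neg_cancel_comm,
      Complex.norm_exp_ofReal_mul_I, Real.log_one, mul_zero] at h
    linarith
  · have hs := one_add_exp_add_exp_mem_slitPlane ha hb
    have h1 := ((hasDerivAt_exp_mul_I b).const_add (1 + Complex.exp (a * Complex.I))).clog_real hs
    have h2 := (Complex.reCLM.hasFDerivAt.comp_hasDerivAt b h1)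
    have h3 := (hasDerivAt_id b).mul h2
    simp only [Complex.reCLM_apply, Function.comp_def, Complex.log_re, id, one_mul] at h3
    exact h3

theorem integral_integral_log_arc :
    ∫ a in (0 : ℝ)..Real.pi, ∫ b in (0 : ℝ)..Real.pi,
      Real.log ‖1 + Complex.exp (a * Complex.I) + Complex.exp (b * Complex.I)‖
    = -∫ b in (0 : ℝ)..Real.pi, (b * ∫ a in (0 : ℝ)..Real.pi, arcLogDeriv a b).re := by
  have h : ∫ a in (0 : ℝ)..Real.pi, ∫ b in (0 : ℝ)..Real.pi,
      Real.log ‖1 + Complex.exp (a * Complex.I) + Complex.exp (b * Complex.I)‖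
      = ∫ a in (0 : ℝ)..Real.pi, -∫ b in (0 : ℝ)..Real.pi, b * (arcLogDeriv a b).re :=
    intervalIntegral.integral_congr fun a ha => integral_log_arc (by
      rwa [Set.uIcc_of_le Real.pi_pos.le] at ha)
  rw [h, intervalIntegral.integral_neg, intervalIntegral_intervalIntegral_swap]
  · congr 1
    refine intervalIntegral.integral_congr fun b hb => ?_
    rw [Set.uIcc_of_le Real.pi_pos.le] at hb
    have c : ContinuousOn (fun a : ℝ => arcLogDeriv a b) (Set.Icc 0 Real.pi) :=
      continuousOn_arcLogDeriv.comp (f := fun a : ℝ => (a, b)) (by fun_prop) fun a ha => ⟨ha, hb⟩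
    have i1 := c.intervalIntegrable_of_Icc (μ := volume) Real.pi_pos.le
    have := intervalIntegral.intervalIntegral_re i1
    simp only [Complex.re_ofReal_mul, intervalIntegral.integral_const_mul]
    congr 1
  · have c : ContinuousOn (Function.uncurry fun a b : ℝ => b * (arcLogDeriv a b).re)
        (Set.Icc 0 Real.pi ×ˢ Set.Icc 0 Real.pi) :=
      continuousOn_snd.mul (Complex.continuous_re.comp_continuousOn continuousOn_arcLogDeriv)
    have := c.integrableOn_compact (μ := volume) (isCompact_Icc.prod isCompact_Icc)
    rw [Set.uIoc_of_le Real.pi_pos.le]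
    refine this.mono_set ?_
    exact Set.prod_mono Set.Ioc_subset_Icc_self Set.Ioc_subset_Icc_self

/-- With w = 1 + e^(ib), a primitive of 1/(w + e^(ia)) is (a + i log(w + e^(ia)))/w. The argument of
the logarithm stays in the upper half-plane, and at a = π it is e^(ib). -/
theorem integral_arcLogDeriv {b : ℝ} (hb : b ∈ Set.Ioo 0 Real.pi) :
    ∫ a in (0 : ℝ)..Real.pi, arcLogDeriv a b
      = Complex.exp (b * Complex.I) * Complex.I * ((Real.pi - b - Complex.I *
        Complex.log (2 + Complex.exp (b * Complex.I))) / (1 + Complex.exp (b * Complex.I))) := by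
  have hw : 1 + Complex.exp (b * Complex.I) ≠ 0 := fun h => by
    have := congrArg Complex.im h
    simp only [Complex.add_im, Complex.one_im, Complex.exp_ofReal_mul_I_im, Complex.zero_im] at this
    linarith [Real.sin_pos_of_mem_Ioo hb]
  have hd : ∀ a ∈ Set.uIcc 0 Real.pi, HasDerivAt (fun a : ℝ => Complex.exp (b * Complex.I) *
      Complex.I * ((a + Complex.I * Complex.log (1 + Complex.exp (a * Complex.I) +
        Complex.exp (b * Complex.I))) / (1 + Complex.exp (b * Complex.I)))) (arcLogDeriv a b) a := by
    intro a ha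
    rw [Set.uIcc_of_le Real.pi_pos.le] at ha
    have hs := one_add_exp_add_exp_mem_slitPlane ha hb
    have h0 := Complex.slitPlane_ne_zero hs
    have h1 := (((hasDerivAt_exp_mul_I a).const_add 1).add_const
      (Complex.exp (b * Complex.I))).clog_real hs
    have h2 := (((hasDerivAt_id a).ofReal_comp.add (h1.const_mul Complex.I)).div_const
      (1 + Complex.exp (b * Complex.I))).const_mul (Complex.exp (b * Complex.I) * Complex.I)
    refine h2.congr_deriv ?_
    rw [arcLogDeriv, Complex.ofReal_one]
    generalize Complex.exp (a * Complex.I) = u at *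
    generalize Complex.exp (b * Complex.I) = v at *
    field_simp
    linear_combination u * v * Complex.I_sq
  rw [intervalIntegral.integral_eq_sub_of_hasDerivAt hd]
  · have hl : Complex.log (Complex.exp (b * Complex.I)) = b * Complex.I := by
      refine Complex.log_exp ?_ ?_ <;> simp <;> linarith [hb.1, hb.2, Real.pi_pos]
    simp only [Complex.exp_pi_mul_I, add_neg_cancel, zero_add, hl, Complex.ofReal_zero, zero_mul,
      Complex.exp_zero]
    rw [← mul_sub, ← sub_div]
    norm_num
    congr 2
    linear_combination (b : ℂ) * Complex.I_sq
  · have c : ContinuousOn (fun a : ℝ => arcLogDeriv a b) (Set.Icc 0 Real.pi) :=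
      continuousOn_arcLogDeriv.comp (f := fun a : ℝ => (a, b)) (by fun_prop)
        fun a ha => ⟨ha, hb.1.le, hb.2.le⟩
    exact c.intervalIntegrable_of_Icc Real.pi_pos.le

/-! ### Shifting the contour to the horizontal edges -/

/-- The numerator `π + iz - i log (2 + exp z)`, which vanishes at `iπ`. -/
noncomputable def arcNum (z : ℂ) : ℂ :=
  Real.pi + Complex.I * z - Complex.I * Complex.log (2 + Complex.exp z)

/-- The function `z exp z (π + iz - i log (2 + exp z)) / (1 + exp z)`, with its removable
singularity at `iπ` removed. -/
noncomputable def arcFun (z : ℂ) : ℂ :=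
  z * Complex.exp z * (dslope arcNum (Real.pi * Complex.I) z /
    dslope (fun z => 1 + Complex.exp z) (Real.pi * Complex.I) z)

theorem arcNum_pi : arcNum (Real.pi * Complex.I) = 0 := by
  rw [arcNum, Complex.exp_pi_mul_I]
  norm_num
  linear_combination (Real.pi : ℂ) * Complex.I_sq

theorem arcFun_of_ne {z : ℂ} (hz : z ≠ Real.pi * Complex.I) :
    arcFun z = z * Complex.exp z * (arcNum z / (1 + Complex.exp z)) := by
  have h : z - Real.pi * Complex.I ≠ 0 := sub_ne_zero.2 hz
  rw [arcFun, dslope_of_ne _ hz, dslope_of_ne _ hz, slope_def_field, slope_def_field, arcNum_pi,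
    Complex.exp_pi_mul_I, add_neg_cancel, sub_zero, sub_zero, div_div_div_cancel_right₀ h]

theorem one_le_re_two_add_exp {z : ℂ} (hz : z.re ≤ 0) : 1 ≤ (2 + Complex.exp z).re := by
  have h1 : ‖Complex.exp z‖ ≤ 1 := by rw [Complex.norm_exp]; exact Real.exp_le_one_iff.2 hz
  have h2 := (abs_le.1 (Complex.abs_re_le_norm (Complex.exp z))).1
  simp only [Complex.add_re, Complex.re_ofNat]
  linarith

theorem two_add_exp_mem_slitPlane {z : ℂ} (hz : z.re ≤ 0) :
    2 + Complex.exp z ∈ Complex.slitPlane :=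
  Or.inl (by linarith [one_le_re_two_add_exp hz])

theorem differentiableAt_arcNum {z : ℂ} (hz : z.re ≤ 0) : DifferentiableAt ℂ arcNum z := by
  have h : DifferentiableAt ℂ (fun z => Complex.log (2 + Complex.exp z)) z :=
    DifferentiableAt.clog (by fun_prop) (two_add_exp_mem_slitPlane hz)
  unfold arcNum
  fun_prop

theorem one_add_exp_ne_zero {z : ℂ} (h0 : 0 ≤ z.im) (h1 : z.im ≤ Real.pi)
    (hz : z ≠ Real.pi * Complex.I) : 1 + Complex.exp z ≠ 0 := by
  intro h
  have he : Complex.exp (z - Real.pi * Complex.I) = 1 := by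
    rw [Complex.exp_sub, Complex.exp_pi_mul_I]
    linear_combination -h
  obtain ⟨n, hn⟩ := Complex.exp_eq_one_iff.1 he
  have hi := congrArg Complex.im hn
  simp at hi
  have hp := Real.pi_pos
  have hn0 : n = 0 := by
    have h2 : (n : ℝ) ≤ 0 := by by_contra! h; nlinarith
    have h3 : (-1 : ℝ) < n := by by_contra! h; nlinarith
    have h2' : n ≤ 0 := by exact_mod_cast h2
    have h3' : -1 < n := by exact_mod_cast h3
    omega
  rw [hn0] at hn
  apply hz
  simpa [sub_eq_zero] using hn

theorem dslope_one_add_exp_ne_zero {z : ℂ} (h0 : 0 ≤ z.im) (h1 : z.im ≤ Real.pi) :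
    dslope (fun z => 1 + Complex.exp z) (Real.pi * Complex.I) z ≠ 0 := by
  rcases eq_or_ne z (Real.pi * Complex.I) with rfl | hz
  · rw [dslope_same]
    simp
  · rw [dslope_of_ne _ hz, slope_def_field, Complex.exp_pi_mul_I, add_neg_cancel, sub_zero]
    exact div_ne_zero (one_add_exp_ne_zero h0 h1 hz) (sub_ne_zero.2 hz)

theorem continuousAt_arcFun {z : ℂ} (hr : z.re ≤ 0) (h0 : 0 ≤ z.im) (h1 : z.im ≤ Real.pi) :
    ContinuousAt arcFun z := by
  have hc : ∀ f : ℂ → ℂ, DifferentiableAt ℂ f z →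
      ContinuousAt (dslope f (Real.pi * Complex.I)) z := fun f hf => by
    rcases eq_or_ne z (Real.pi * Complex.I) with rfl | hz
    · exact continuousAt_dslope_same.2 hf
    · exact (continuousAt_dslope_of_ne hz).2 hf.continuousAt
  exact ContinuousAt.mul (by fun_prop) (ContinuousAt.div (hc _ (differentiableAt_arcNum hr))
    (hc _ (by fun_prop)) (dslope_one_add_exp_ne_zero h0 h1))

theorem differentiableAt_arcFun {z : ℂ} (hr : z.re ≤ 0) (h0 : 0 ≤ z.im) (h1 : z.im < Real.pi) :
    DifferentiableAt ℂ arcFun z := by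
  have hz : z ≠ Real.pi * Complex.I := by
    rintro rfl
    simp at h1
  have hd : ∀ f : ℂ → ℂ, DifferentiableAt ℂ f z →
      DifferentiableAt ℂ (dslope f (Real.pi * Complex.I)) z := fun f hf =>
    (differentiableAt_dslope_of_ne hz).2 hf
  exact DifferentiableAt.mul (by fun_prop) (DifferentiableAt.div
    (hd _ (differentiableAt_arcNum hr)) (hd _ (by fun_prop))
    (dslope_one_add_exp_ne_zero h0 h1.le))

/-- At z = ib one has iz = -b, so `arcFun` continues the integrand in b holomorphically. -/
theorem arcFun_I {b : ℝ} (hb : b ∈ Set.Ioo 0 Real.pi) :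
    (b * ∫ a in (0 : ℝ)..Real.pi, arcLogDeriv a b) = arcFun (b * Complex.I) := by
  have hz : (b : ℂ) * Complex.I ≠ Real.pi * Complex.I := by
    intro h
    have := mul_right_cancel₀ Complex.I_ne_zero h
    exact hb.2.ne (by exact_mod_cast this)
  rw [integral_arcLogDeriv hb, arcFun_of_ne hz, arcNum]
  linear_combination (-(b : ℂ) * Complex.exp (b * Complex.I) * Complex.I *
    (b / (1 + Complex.exp (b * Complex.I)))) * Complex.I_sq

theorem integral_log_arc_eq_arcFun :
    ∫ a in (0 : ℝ)..Real.pi, ∫ b in (0 : ℝ)..Real.pi,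
      Real.log ‖1 + Complex.exp (a * Complex.I) + Complex.exp (b * Complex.I)‖
    = -(∫ b in (0 : ℝ)..Real.pi, arcFun (b * Complex.I)).re := by
  have c : ContinuousOn (fun b : ℝ => arcFun (b * Complex.I)) (Set.Icc 0 Real.pi) := fun b hb =>
    ((continuousAt_arcFun (z := b * Complex.I) (by simp) (by simpa using hb.1)
      (by simpa using hb.2)).comp (f := fun b : ℝ => (b : ℂ) * Complex.I)
      (by fun_prop)).continuousWithinAt
  have i1 := c.intervalIntegrable_of_Icc (μ := volume) Real.pi_pos.le
  rw [integral_integral_log_arc]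
  refine congrArg Neg.neg (Eq.trans ?_ (intervalIntegral.intervalIntegral_re i1))
  refine intervalIntegral.integral_congr_Ioo_of_le Real.pi_pos.le fun b hb => ?_
  simp only [arcFun_I hb]
  rfl

theorem arcFun_ofReal_im {x : ℝ} : (arcFun x).im
    = x * Real.exp x * ((x - Real.log (2 + Real.exp x)) / (1 + Real.exp x)) := by
  have hz : (x : ℂ) ≠ Real.pi * Complex.I := by
    intro h
    have := congrArg Complex.im h
    simp [Real.pi_ne_zero.symm] at this
  have e : arcFun x = ((x * Real.exp x / (1 + Real.exp x) : ℝ) : ℂ) *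
      (Real.pi + ((x - Real.log (2 + Real.exp x) : ℝ) : ℂ) * Complex.I) := by
    rw [arcFun_of_ne hz, arcNum]
    push_cast
    rw [Complex.ofReal_log (by positivity)]
    push_cast
    ring
  rw [e, Complex.im_ofReal_mul]
  simp
  ring

theorem arcFun_ofReal_add_pi_im {x : ℝ} (hx : x < 0) : (arcFun (x + Real.pi * Complex.I)).im
    = -(x * Real.exp x * ((x - Real.log (2 - Real.exp x)) / (1 - Real.exp x))) := by
  have hz : (x : ℂ) + Real.pi * Complex.I ≠ Real.pi * Complex.I := by
    intro h
    have : (x : ℂ) = 0 := by linear_combination h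
    exact hx.ne (by exact_mod_cast this)
  have h1 : Real.exp x < 1 := by simpa using hx
  have e : arcFun (x + Real.pi * Complex.I) =
      ((-(Real.exp x * (x - Real.log (2 - Real.exp x)) / (1 - Real.exp x)) : ℝ) : ℂ) *
      (x * Complex.I - Real.pi) := by
    rw [arcFun_of_ne hz, arcNum, Complex.exp_add, Complex.exp_pi_mul_I, mul_neg_one,
      ← sub_eq_add_neg, ← sub_eq_add_neg]
    push_cast
    rw [Complex.ofReal_log (by linarith)]
    push_cast
    linear_combination (-(Complex.exp x / (1 - Complex.exp x)) * (Real.pi *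
      (x - Complex.log (2 - Complex.exp x)) + (x + Real.pi * Complex.I) * Real.pi)) * Complex.I_sq
  rw [e, Complex.im_ofReal_mul]
  simp
  ring

theorem image_exp_Ioo (R : ℝ) : Real.exp '' Set.Ioo (-R) 0 = Set.Ioo (Real.exp (-R)) 1 := by
  ext u
  constructor
  · rintro ⟨t, ht, rfl⟩
    exact ⟨Real.exp_lt_exp.2 ht.1, by simpa using ht.2⟩
  · rintro ⟨h0, h1⟩
    have hu : 0 < u := (Real.exp_pos _).trans h0
    exact ⟨Real.log u, ⟨(Real.lt_log_iff_exp_lt hu).2 h0, Real.log_neg hu h1⟩, Real.exp_log hu⟩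

theorem continuousOn_arcFun_horizontal {y : ℝ} (h0 : 0 ≤ y) (h1 : y ≤ Real.pi) (R : ℝ) :
    ContinuousOn (fun x : ℝ => arcFun (x + y * Complex.I)) (Set.Icc (-R) 0) := fun x hx =>
  ((continuousAt_arcFun (z := x + y * Complex.I) (by simpa using hx.2) (by simpa using h0)
    (by simpa using h1)).comp (f := fun x : ℝ => (x : ℂ) + y * Complex.I)
    (by fun_prop)).continuousWithinAt

/-- Cauchy's theorem for `arcFun` on the rectangle `[-R, 0] × [0, π]`. -/
theorem re_integral_arcFun {R : ℝ} (hR : 0 ≤ R) :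
    (∫ b in (0 : ℝ)..Real.pi, arcFun (b * Complex.I)).re
      = (∫ b in (0 : ℝ)..Real.pi, arcFun ((-R : ℝ) + b * Complex.I)).re
        - ∫ s in Real.exp (-R)..1, (Real.log s * (Real.log s - Real.log (2 - s)) / (1 - s)
          + Real.log s * (Real.log s - Real.log (2 + s)) / (1 + s)) := by
  have hp := Real.pi_pos
  -- Holomorphy is needed only inside the rectangle; at the corner iπ continuity suffices.
  have hrect := Complex.integral_boundary_rect_eq_zero_of_continuousOn_of_differentiableOn arcFun
    ((-R : ℝ) : ℂ) (Real.pi * Complex.I) (fun z hz => ?_) (fun z hz => ?_)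
  · have c0 := (continuousOn_arcFun_horizontal le_rfl hp.le R).intervalIntegrable_of_Icc
      (μ := volume) (by linarith)
    have c1 := (continuousOn_arcFun_horizontal hp.le le_rfl R).intervalIntegrable_of_Icc
      (μ := volume) (by linarith)
    simp only [Complex.ofReal_re, Complex.ofReal_im, Complex.re_ofReal_mul, Complex.I_re, mul_zero,
      Complex.im_ofReal_mul, Complex.I_im, mul_one, Complex.ofReal_zero, zero_mul, zero_add,
      smul_eq_mul] at hrect
    -- The vertical sides carry a factor i, so imaginary parts link their real parts to the
    -- imaginary parts of the horizontal sides.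
    have him := congrArg Complex.im hrect
    rw [Complex.sub_im, Complex.add_im, Complex.sub_im, Complex.I_mul_im, Complex.I_mul_im,
      Complex.zero_im] at him
    have e0 : (∫ x in -R..0, arcFun (x + (0 : ℝ) * Complex.I)).im
        = ∫ x in -R..0, (arcFun (x + (0 : ℝ) * Complex.I)).im :=
      (intervalIntegral.intervalIntegral_im c0).symm
    have e1 : (∫ x in -R..0, arcFun (x + Real.pi * Complex.I)).im
        = ∫ x in -R..0, (arcFun (x + Real.pi * Complex.I)).im :=
      (intervalIntegral.intervalIntegral_im c1).symm
    have i0 : IntervalIntegrable (fun x : ℝ => (arcFun (x + (0 : ℝ) * Complex.I)).im)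
      volume (-R) 0 := intervalIntegrable_iff.2 (intervalIntegrable_iff.1 c0).im
    have i1 : IntervalIntegrable (fun x : ℝ => (arcFun (x + Real.pi * Complex.I)).im)
      volume (-R) 0 := intervalIntegrable_iff.2 (intervalIntegrable_iff.1 c1).im
    have e2 : ∫ s in Real.exp (-R)..1, (Real.log s * (Real.log s - Real.log (2 - s)) / (1 - s)
          + Real.log s * (Real.log s - Real.log (2 + s)) / (1 + s))
        = (∫ x in -R..0, (arcFun (x + (0 : ℝ) * Complex.I)).im)
          - ∫ x in -R..0, (arcFun (x + Real.pi * Complex.I)).im := by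
      rw [← intervalIntegral.integral_sub i0 i1, (intervalIntegral_subst (φ := Real.exp)
        (φ' := Real.exp) (a := -R) (b := 0) (by linarith) (by simpa using hR) (image_exp_Ioo R)
        (fun t _ => Real.hasDerivAt_exp t) Real.exp_injective.injOn).2]
      refine intervalIntegral.integral_congr_Ioo_of_le (by linarith) fun x hx => ?_
      simp only [Complex.ofReal_zero, zero_mul, add_zero]
      rw [arcFun_ofReal_im, arcFun_ofReal_add_pi_im hx.2, Real.log_exp,
        abs_of_pos (Real.exp_pos _)]
      ring
    rw [e2, ← e0, ← e1]
    simp only [Complex.ofReal_zero, zero_mul, add_zero] at him ⊢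
    linarith
  · rw [Complex.mem_reProdIm] at hz
    simp only [Complex.ofReal_re, Complex.ofReal_im, Complex.re_ofReal_mul, Complex.I_re, mul_zero,
      Complex.im_ofReal_mul, Complex.I_im, mul_one] at hz
    rw [Set.uIcc_of_le (by linarith), Set.uIcc_of_le hp.le] at hz
    exact (continuousAt_arcFun hz.1.2 hz.2.1 hz.2.2).continuousWithinAt
  · rw [Complex.mem_reProdIm] at hz
    simp only [Complex.ofReal_re, Complex.ofReal_im, Complex.re_ofReal_mul, Complex.I_re, mul_zero,
      Complex.im_ofReal_mul, Complex.I_im, mul_one] at hz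
    rw [min_eq_left (by linarith), max_eq_right (by linarith), min_eq_left hp.le,
      max_eq_right hp.le] at hz
    exact (differentiableAt_arcFun hz.1.2.le hz.2.1.le hz.2.2).differentiableWithinAt

theorem norm_arcFun_le {R b : ℝ} (hR : 1 ≤ R) (hb : b ∈ Set.Icc 0 Real.pi) :
    ‖arcFun ((-R : ℝ) + b * Complex.I)‖ ≤ 2 * ((R + 14) ^ 2 * Real.exp (-R)) := by
  set z : ℂ := (-R : ℝ) + b * Complex.I with hz
  have hre : z.re = -R := by simp [hz]
  have hne : z ≠ Real.pi * Complex.I := by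
    intro h
    have := congrArg Complex.re h
    rw [hre] at this
    simp at this
    linarith
  have hp := Real.pi_le_four
  have nz : ‖z‖ ≤ R + 4 := by
    refine (norm_add_le _ _).trans ?_
    rw [norm_mul, Complex.norm_I, Complex.norm_real, Complex.norm_real, Real.norm_eq_abs,
      Real.norm_eq_abs, abs_neg, abs_of_nonneg hb.1, abs_of_pos (by linarith)]
    linarith [hb.2]
  have ne : ‖Complex.exp z‖ = Real.exp (-R) := by rw [Complex.norm_exp, hre]
  have he : Real.exp (-R) ≤ 1 / 2 := by
    have h1 : Real.exp (-R) ≤ Real.exp (-1) := Real.exp_le_exp.2 (by linarith)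
    have := Real.exp_neg_one_lt_d9
    linarith
  have nd : 1 / 2 ≤ ‖1 + Complex.exp z‖ := by
    have := norm_sub_norm_le (1 : ℂ) (-Complex.exp z)
    rw [norm_neg, norm_one, ne, sub_neg_eq_add] at this
    linarith
  have nl : ‖Complex.log (2 + Complex.exp z)‖ ≤ 6 := by
    refine (Complex.norm_le_abs_re_add_abs_im _).trans ?_
    rw [Complex.log_re, Complex.log_im]
    have h1 : 1 ≤ ‖2 + Complex.exp z‖ :=
      (one_le_re_two_add_exp (by rw [hre]; linarith)).trans (Complex.re_le_norm _)
    have h2 : ‖2 + Complex.exp z‖ ≤ 3 := by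
      refine (norm_add_le _ _).trans ?_
      rw [ne, Complex.norm_ofNat]
      linarith
    have h3 := Real.log_le_sub_one_of_pos (zero_lt_one.trans_le h1)
    rw [abs_of_nonneg (Real.log_nonneg h1)]
    linarith [Complex.abs_arg_le_pi (2 + Complex.exp z)]
  -- The bound is π + |z| + |log(2 + e^z)| ≤ 4 + (R + 4) + 6.
  have nn : ‖arcNum z‖ ≤ R + 14 := by
    rw [arcNum]
    refine (norm_sub_le _ _).trans ((add_le_add_left (norm_add_le _ _) _).trans ?_)
    rw [norm_mul, norm_mul, Complex.norm_I, Complex.norm_real, Real.norm_of_nonneg Real.pi_pos.le]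
    linarith
  rw [arcFun_of_ne hne, norm_mul, norm_mul, norm_div, ne]
  have nq : ‖arcNum z‖ / ‖1 + Complex.exp z‖ ≤ 2 * (R + 14) := by
    rw [div_le_iff₀ (by linarith)]
    nlinarith
  calc ‖z‖ * Real.exp (-R) * (‖arcNum z‖ / ‖1 + Complex.exp z‖)
      ≤ (R + 14) * Real.exp (-R) * (2 * (R + 14)) := by gcongr; linarith
    _ = _ := by ring

theorem tendsto_integral_arcFun : Filter.Tendsto
    (fun R : ℝ => (∫ b in (0 : ℝ)..Real.pi, arcFun ((-R : ℝ) + b * Complex.I)).re)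
    Filter.atTop (nhds 0) := by
  have h1 : Filter.Tendsto (fun R : ℝ => 2 * ((R + 14) ^ 2 * Real.exp (-R)) * |Real.pi - 0|)
      Filter.atTop (nhds 0) := by
    have h := (Real.tendsto_pow_mul_exp_neg_atTop_nhds_zero 2).comp
      (Filter.tendsto_atTop_add_const_right Filter.atTop (14 : ℝ) Filter.tendsto_id)
    have h2 := h.const_mul (2 * Real.exp 14 * |Real.pi - 0|)
    rw [mul_zero] at h2
    refine h2.congr fun R => ?_
    simp only [Function.comp, id]
    rw [neg_add, Real.exp_add, Real.exp_neg 14]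
    field_simp
  refine squeeze_zero_norm' ?_ h1
  filter_upwards [Filter.eventually_ge_atTop 1] with R hR
  refine (Complex.abs_re_le_norm _).trans
    (intervalIntegral.norm_integral_le_of_norm_le_const fun b hb => ?_)
  rw [Set.uIoc_of_le Real.pi_pos.le] at hb
  exact norm_arcFun_le hR ⟨hb.1.le, hb.2⟩

/-- With s = |1 - t|, the intervals (0, 1) and (1, 2) in t fold onto (0, 1) in s; the cutoff removes
(1 - e^(-R), 1 + e^(-R)). -/
theorem tendsto_integral_log_kernel : Filter.Tendsto
    (fun R : ℝ => ∫ s in Real.exp (-R)..1, (Real.log s * (Real.log s - Real.log (2 - s)) / (1 - s)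
          + Real.log s * (Real.log s - Real.log (2 + s)) / (1 + s)))
    Filter.atTop (nhds (14 / 3 * zetaThree)) := by
  obtain ⟨hi, hv⟩ := integral_log_mul_log_div
  set k : ℝ → ℝ := fun t => Real.log (1 - t) * (Real.log (1 - t) - Real.log (1 + t)) / t with hk
  have isub : ∀ {a b : ℝ}, a ∈ Set.Icc (0 : ℝ) 2 → b ∈ Set.Icc (0 : ℝ) 2 →
      IntervalIntegrable k volume a b := fun ha hb => hi.mono_set (by
    rw [Set.uIcc_of_le (by norm_num : (0 : ℝ) ≤ 2)]
    exact Set.uIcc_subset_Icc ha hb)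
  have hprim : ContinuousOn (fun x => ∫ t in (0 : ℝ)..x, k t) (Set.Icc 0 2) := by
    have := intervalIntegral.continuousOn_primitive_interval (μ := volume) (a := 0) (b := 2)
      (f := k) (by
        rw [Set.uIcc_of_le (by norm_num), integrableOn_Icc_iff_integrableOn_Ioc]
        exact (intervalIntegrable_iff_integrableOn_Ioc_of_le (by norm_num)).1 hi)
    rwa [Set.uIcc_of_le (by norm_num)] at this
  have hat : ContinuousAt (fun x => ∫ t in (0 : ℝ)..x, k t) 1 :=
    hprim.continuousAt (Icc_mem_nhds (by norm_num) (by norm_num))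
  have he : Filter.Tendsto (fun R : ℝ => Real.exp (-R)) Filter.atTop (nhds 0) :=
    Real.tendsto_exp_neg_atTop_nhds_zero
  have h1 : Filter.Tendsto (fun R : ℝ => ∫ t in (0 : ℝ)..1 - Real.exp (-R), k t) Filter.atTop
      (nhds (∫ t in (0 : ℝ)..1, k t)) :=
    Filter.Tendsto.comp hat (by simpa using he.const_sub 1)
  have h2 : Filter.Tendsto (fun R : ℝ => ∫ t in (0 : ℝ)..1 + Real.exp (-R), k t) Filter.atTop
      (nhds (∫ t in (0 : ℝ)..1, k t)) :=
    Filter.Tendsto.comp hat (by simpa using he.const_add 1)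
  have h3 := h1.add (h2.const_sub (∫ t in (0 : ℝ)..2, k t))
  rw [add_sub_cancel, hv] at h3
  refine h3.congr' ?_
  filter_upwards [Filter.eventually_ge_atTop 0] with R hR
  have e1 : Real.exp (-R) ≤ 1 := by simpa using hR
  have e0 := Real.exp_pos (-R)
  have m1 : IntervalIntegrable k volume 0 (1 - Real.exp (-R)) :=
    isub (by norm_num) ⟨by linarith, by linarith⟩
  have m2 : IntervalIntegrable k volume (1 + Real.exp (-R)) 2 :=
    isub ⟨by linarith, by linarith⟩ (by norm_num)
  have m3 : IntervalIntegrable k volume 0 (1 + Real.exp (-R)) :=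
    isub (by norm_num) ⟨by linarith, by linarith⟩
  have n1 := (m1.comp_sub_left 1).symm
  have n2 := m2.comp_add_left 1
  rw [sub_sub_cancel, sub_zero] at n1
  rw [add_sub_cancel_left, show (2 : ℝ) - 1 = 1 by norm_num] at n2
  rw [← hv, intervalIntegral.integral_interval_sub_left hi m3]
  have s1 := intervalIntegral.integral_comp_sub_left (a := Real.exp (-R)) (b := 1) k 1
  have s2 := intervalIntegral.integral_comp_add_left (a := Real.exp (-R)) (b := 1) k 1
  rw [sub_self] at s1
  rw [show (1 : ℝ) + 1 = 2 by norm_num] at s2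
  rw [← s1, ← s2, ← intervalIntegral.integral_add n1 n2]
  refine intervalIntegral.integral_congr fun s _ => ?_
  simp only [hk]
  rw [sub_sub_cancel, show 1 - (1 + s) = -s by ring, Real.log_neg_eq_log,
    show 1 + (1 - s) = 2 - s by ring, show 1 + (1 + s) = 2 + s by ring]

/-- The integral of `log |1 + x + y|` over the product of two upper half circles. -/
theorem integral_log_arc_eq :
    ∫ a in (0 : ℝ)..Real.pi, ∫ b in (0 : ℝ)..Real.pi,
      Real.log ‖1 + Complex.exp (a * Complex.I) + Complex.exp (b * Complex.I)‖
    = 14 / 3 * zetaThree := by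
  rw [integral_log_arc_eq_arcFun]
  have h := tendsto_integral_arcFun.sub tendsto_integral_log_kernel
  have hc : Filter.Tendsto (fun _ : ℝ => (∫ b in (0 : ℝ)..Real.pi, arcFun (b * Complex.I)).re)
      Filter.atTop (nhds (0 - 14 / 3 * zetaThree)) := by
    refine h.congr' ?_
    filter_upwards [Filter.eventually_ge_atTop 0] with R hR
    exact (re_integral_arcFun hR).symm
  rw [tendsto_nhds_unique tendsto_const_nhds hc]
  ring

/-! ### Jensen's formula and integrability on the torus -/

/-- The point `exp (2πit)` of the unit circle. -/
noncomputable def circlePt (t : ℝ) : ℂ := Complex.exp ((2 * Real.pi * t : ℝ) * Complex.I)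

@[fun_prop]
theorem continuous_circlePt : Continuous circlePt := by unfold circlePt; fun_prop

@[fun_prop]
theorem measurable_circlePt : Measurable circlePt := continuous_circlePt.measurable

theorem norm_circlePt (t : ℝ) : ‖circlePt t‖ = 1 := Complex.norm_exp_ofReal_mul_I _

theorem ae_circlePt_ne (c : ℂ) : ∀ᵐ t : ℝ, circlePt t ≠ c := by
  have h : {t : ℝ | circlePt t = c}.Countable := by
    rcases Set.eq_empty_or_nonempty {t : ℝ | circlePt t = c} with h | ⟨s, hs⟩
    · rw [h]; exact Set.countable_empty
    · refine (Set.countable_range fun n : ℤ => s + n).mono fun t ht => ?_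
      have he : circlePt t = circlePt s := Eq.trans ht (Eq.symm hs)
      obtain ⟨n, hn⟩ := Complex.exp_eq_exp_iff_exists_int.1 he
      refine ⟨n, ?_⟩
      have h2 : (2 * Real.pi * Complex.I) * ((s : ℂ) + n - t) = 0 := by
        push_cast at hn
        linear_combination -hn
      have h3 := (mul_eq_zero.1 h2).resolve_left Complex.two_pi_I_ne_zero
      have h4 : ((s + n - t : ℝ) : ℂ) = 0 := by push_cast; exact h3
      have h5 : s + n - t = 0 := by exact_mod_cast h4
      simp only
      linarith
  exact measure_mono_null (fun t ht => by simpa using ht) (h.measure_zero volume)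

theorem integral_circlePt (f : ℂ → ℝ) :
    ∫ t in (0 : ℝ)..1, f (circlePt t) = Real.circleAverage f 0 1 := by
  have := intervalIntegral.integral_comp_mul_left (a := 0) (b := 1)
    (fun θ => f (circleMap 0 1 θ)) Real.two_pi_pos.ne'
  rw [mul_zero, mul_one] at this
  rw [Real.circleAverage_def, ← this]
  simp [circleMap, circlePt]

theorem intervalIntegrable_circlePt {f : ℂ → ℝ} (hf : CircleIntegrable f 0 1) :
    IntervalIntegrable (fun t => f (circlePt t)) volume 0 1 := by
  have := IntervalIntegrable.comp_mul_left (c := 2 * Real.pi) hf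
  simpa [circleMap, circlePt, Real.pi_ne_zero] using this

/-- Jensen's formula for a linear polynomial on the unit circle. -/
theorem integral_log_norm_add_mul_circlePt (A B : ℂ) :
    IntervalIntegrable (fun t => Real.log ‖A + B * circlePt t‖) volume 0 1 ∧
    ∫ t in (0 : ℝ)..1, Real.log ‖A + B * circlePt t‖ = Real.log (max ‖A‖ ‖B‖) := by
  rcases eq_or_ne B 0 with rfl | hB
  · simp
  have hB' : ‖B‖ ≠ 0 := norm_ne_zero_iff.2 hB
  have hBp : 0 < ‖B‖ := norm_pos_iff.2 hB
  have hae : ∀ᵐ t : ℝ, Real.log ‖B‖ + Real.log ‖circlePt t - -(A / B)‖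
      = Real.log ‖A + B * circlePt t‖ := by
    filter_upwards [ae_circlePt_ne (-(A / B))] with t ht
    rw [← Real.log_mul hB' (norm_ne_zero_iff.2 (sub_ne_zero.2 ht)), ← norm_mul]
    congr 2
    field_simp
    ring
  have hi := intervalIntegrable_circlePt
    (circleIntegrable_log_norm_sub_const (a := -(A / B)) (c := 0) 1)
  refine ⟨((intervalIntegrable_const (c := Real.log ‖B‖)).add hi).congr_ae (ae_restrict_of_ae hae),
    ?_⟩
  rw [← intervalIntegral.integral_congr_ae (hae.mono fun t h _ => h),
    intervalIntegral.integral_add intervalIntegrable_const hi,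
    integral_circlePt (fun z => Real.log ‖z - -(A / B)‖),
    circleAverage_log_norm_sub_const_eq_posLog, norm_neg, norm_div]
  simp only [intervalIntegral.integral_const, sub_zero, one_smul]
  rcases le_total ‖A‖ ‖B‖ with h | h
  · rw [max_eq_right h, Real.posLog_eq_zero_iff _ |>.2, add_zero]
    rw [abs_of_nonneg (by positivity)]
    exact div_le_one_of_le₀ h hBp.le
  · have hA : 0 < ‖A‖ := hBp.trans_le h
    rw [max_eq_left h, Real.posLog_eq_log, Real.log_div hA.ne' hB']
    · ring
    · rw [abs_of_nonneg (by positivity)]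
      exact (one_le_div hBp).2 h

/-- A measurable function bounded above whose sections and iterated integral are integrable is
integrable on the product. -/
theorem integrable_prod_of_le {α β : Type*} [MeasurableSpace α] [MeasurableSpace β]
    {μ : Measure α} {ν : Measure β} [IsFiniteMeasure μ] [IsFiniteMeasure ν] {f : α × β → ℝ}
    (hf : Measurable f) {C : ℝ} (hC : 0 ≤ C) (hle : ∀ p, f p ≤ C)
    (hsec : ∀ x, Integrable (fun y => f (x, y)) ν)
    (hint : Integrable (fun x => ∫ y, f (x, y) ∂ν) μ) : Integrable f (μ.prod ν) := by
  refine (integrable_prod_iff hf.aestronglyMeasurable).2 ⟨Filter.Eventually.of_forall hsec, ?_⟩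
  -- The upper bound f ≤ C gives |f| ≤ 2C - f, whose inner integrals form an integrable function.
  refine Integrable.mono' ((integrable_const (ν.real Set.univ * (2 * C))).sub hint)
    hf.aestronglyMeasurable.norm.integral_prod_right' (Filter.Eventually.of_forall fun x => ?_)
  rw [Real.norm_of_nonneg (integral_nonneg fun y => norm_nonneg _)]
  have h : ∫ y, (2 * C - f (x, y)) ∂ν = ν.real Set.univ * (2 * C) - ∫ y, f (x, y) ∂ν := by
    rw [integral_sub (integrable_const _) (hsec x), integral_const, smul_eq_mul]
  refine (integral_mono (hsec x).norm ((integrable_const _).sub (hsec x)) fun y => ?_).trans h.le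
  have := hle (x, y)
  simp only [Real.norm_eq_abs, Pi.sub_apply]
  exact abs_le.2 ⟨by linarith, by linarith⟩

/-- Normalized Lebesgue measure on the unit interval. -/
noncomputable abbrev unitMeasure : Measure ℝ := volume.restrict (Set.Icc 0 1)

theorem integral_unitMeasure (f : ℝ → ℝ) : ∫ t, f t ∂unitMeasure = ∫ t in (0 : ℝ)..1, f t := by
  rw [intervalIntegral.integral_of_le zero_le_one, integral_Icc_eq_integral_Ioc]

theorem integrable_unitMeasure {f : ℝ → ℝ} (hf : IntervalIntegrable f volume 0 1) :
    Integrable f unitMeasure :=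
  (integrableOn_Icc_iff_integrableOn_Ioc (by simp)).2
    ((intervalIntegrable_iff_integrableOn_Ioc_of_le zero_le_one).1 hf)

/-- Jensen's formula with parameters. -/
theorem integral_prod_log_norm {α : Type*} [MeasurableSpace α] {μ : Measure α}
    [IsFiniteMeasure μ] {A B : α → ℂ} (hA : Measurable A) (hB : Measurable B) {M : ℝ}
    (hM : 1 ≤ M) (hle : ∀ x, ‖A x‖ + ‖B x‖ ≤ M)
    (hint : Integrable (fun x => Real.log (max ‖A x‖ ‖B x‖)) μ) :
    Integrable (fun p : α × ℝ => Real.log ‖A p.1 + B p.1 * circlePt p.2‖) (μ.prod unitMeasure) ∧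
    ∫ p : α × ℝ, Real.log ‖A p.1 + B p.1 * circlePt p.2‖ ∂(μ.prod unitMeasure)
      = ∫ x, Real.log (max ‖A x‖ ‖B x‖) ∂μ := by
  have hv : ∀ x, ∫ t, Real.log ‖A x + B x * circlePt t‖ ∂unitMeasure
      = Real.log (max ‖A x‖ ‖B x‖) := fun x => by
    rw [integral_unitMeasure, (integral_log_norm_add_mul_circlePt _ _).2]
  have hi : Integrable (fun p : α × ℝ => Real.log ‖A p.1 + B p.1 * circlePt p.2‖)
      (μ.prod unitMeasure) := by
    have hm : Measurable fun p : α × ℝ => A p.1 + B p.1 * circlePt p.2 :=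
      (hA.comp measurable_fst).add ((hB.comp measurable_fst).mul
        (measurable_circlePt.comp measurable_snd))
    refine integrable_prod_of_le (f := fun p : α × ℝ => Real.log ‖A p.1 + B p.1 * circlePt p.2‖)
      hm.norm.log (Real.log_nonneg hM) (fun p => ?_)
      (fun x => integrable_unitMeasure (integral_log_norm_add_mul_circlePt (A x) (B x)).1) ?_
    · have h1 : ‖A p.1 + B p.1 * circlePt p.2‖ ≤ M := by
        refine (norm_add_le _ _).trans ?_
        rw [norm_mul, norm_circlePt, mul_one]
        exact hle _
      rcases (norm_nonneg (A p.1 + B p.1 * circlePt p.2)).eq_or_lt with h | h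
      · rw [← h, Real.log_zero]; exact Real.log_nonneg hM
      · exact Real.log_le_log h h1
    · simpa only [hv] using hint
  refine ⟨hi, ?_⟩
  rw [integral_prod _ hi]
  simp only [hv]

/-- Jensen's formula leaves log max(|A|, 1), which is nonnegative and bounded. -/
theorem integrable_log_norm_one_add_add {A : ℝ → ℂ} (hA : Measurable A) (hle : ∀ x, ‖A x‖ ≤ 2) :
    Integrable (fun p : ℝ × ℝ => Real.log ‖A p.1 + circlePt p.2‖)
      (unitMeasure.prod unitMeasure) := by
  have := (integral_prod_log_norm (μ := unitMeasure) (B := fun _ => 1) hA measurable_const (M := 3)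
    (by norm_num) (fun x => by rw [norm_one]; linarith [hle x]) ?_).1
  · simpa using this
  · refine Integrable.mono' (integrable_const 1)
      (Measurable.aestronglyMeasurable (by fun_prop)) (Filter.Eventually.of_forall fun x => ?_)
    have h1 : 1 ≤ max ‖A x‖ ‖(1 : ℂ)‖ := by simp
    rw [Real.norm_of_nonneg (Real.log_nonneg h1)]
    refine (Real.log_le_sub_one_of_pos (by linarith)).trans ?_
    have : max ‖A x‖ ‖(1 : ℂ)‖ ≤ 2 := max_le (hle x) (by norm_num)
    linarith

theorem circlePt_neg (t : ℝ) : circlePt (-t) = (starRingEnd ℂ) (circlePt t) := by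
  rw [circlePt, circlePt, ← Complex.exp_conj, map_mul, Complex.conj_ofReal, Complex.conj_I]
  congr 1
  push_cast
  ring

theorem norm_one_add_circlePt_le (t : ℝ) : ‖1 + circlePt t‖ ≤ 2 := by
  refine (norm_add_le _ _).trans ?_
  rw [norm_one, norm_circlePt]; norm_num

/-- Conjugation moves the inverse from y to x, bringing 1 + x + 1/y to the form with y appearing
linearly. -/
theorem norm_one_add_add_neg (x y : ℝ) :
    ‖1 + circlePt x + circlePt (-y)‖ = ‖1 + circlePt (-x) + circlePt y‖ := by
  rw [← Complex.norm_conj, map_add, map_add, map_one, circlePt_neg, circlePt_neg, Complex.conj_conj]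

theorem abs_log_max_le {p q : ℝ} : |Real.log (max p q)| ≤ |Real.log p| + |Real.log q| := by
  rcases max_choice p q with h | h <;> rw [h] <;>
    linarith [abs_nonneg (Real.log p), abs_nonneg (Real.log q)]

/-- Jensen's formula in the variable `z` for `1 + x + y⁻¹ + c (1 + x + y) z`. -/
theorem integral_prod_log_norm_three {c : ℂ} (hc : ‖c‖ = 1) :
    Integrable (fun p : (ℝ × ℝ) × ℝ => Real.log ‖1 + circlePt p.1.1 + circlePt (-p.1.2)
      + c * (1 + circlePt p.1.1 + circlePt p.1.2) * circlePt p.2‖)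
      ((unitMeasure.prod unitMeasure).prod unitMeasure) ∧
    ∫ p : (ℝ × ℝ) × ℝ, Real.log ‖1 + circlePt p.1.1 + circlePt (-p.1.2)
      + c * (1 + circlePt p.1.1 + circlePt p.1.2) * circlePt p.2‖
      ∂((unitMeasure.prod unitMeasure).prod unitMeasure)
    = ∫ x in (0 : ℝ)..1, ∫ y in (0 : ℝ)..1, Real.log (max ‖1 + circlePt x + circlePt (-y)‖
      ‖1 + circlePt x + circlePt y‖) := by
  have i1 := integrable_log_norm_one_add_add (A := fun x => 1 + circlePt x) (by fun_prop)
    norm_one_add_circlePt_le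
  have i2 := integrable_log_norm_one_add_add (A := fun x => 1 + circlePt (-x)) (by fun_prop)
    (fun x => norm_one_add_circlePt_le (-x))
  simp only [← norm_one_add_add_neg] at i2
  have i3 : Integrable (fun p : ℝ × ℝ => Real.log (max ‖1 + circlePt p.1 + circlePt (-p.2)‖
      ‖1 + circlePt p.1 + circlePt p.2‖)) (unitMeasure.prod unitMeasure) := by
    refine Integrable.mono' (i2.norm.add i1.norm) (Measurable.aestronglyMeasurable (by fun_prop))
      (Filter.Eventually.of_forall fun p => abs_log_max_le)
  have hb : ∀ x y : ℝ, ‖1 + circlePt x + circlePt y‖ ≤ 3 := fun x y => by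
    refine (norm_add_le _ _).trans ?_
    rw [norm_circlePt]; linarith [norm_one_add_circlePt_le x]
  have h := integral_prod_log_norm (μ := unitMeasure.prod unitMeasure)
    (A := fun p => 1 + circlePt p.1 + circlePt (-p.2))
    (B := fun p => c * (1 + circlePt p.1 + circlePt p.2)) (by fun_prop) (by fun_prop) (M := 6)
    (by norm_num) (fun p => by
      rw [norm_mul, hc, one_mul]; linarith [hb p.1 (-p.2), hb p.1 p.2])
    (by simpa only [norm_mul, hc, one_mul] using i3)
  refine ⟨h.1, h.2.trans ?_⟩
  simp only [norm_mul, hc, one_mul]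
  rw [integral_prod _ i3, integral_unitMeasure]
  simp only [integral_unitMeasure]

/-! ### Reduction to the quarter torus -/

/-- Integrability is not assumed: if it fails on (0, c) it fails on (0, 2c), and both integrals take
the default value 0. -/
theorem integral_two_mul_of_symm {g : ℝ → ℝ} {c : ℝ} (hc : 0 ≤ c) (hg : ∀ x, g (2 * c - x) = g x) :
    ∫ x in (0 : ℝ)..2 * c, g x = 2 * ∫ x in (0 : ℝ)..c, g x := by
  by_cases hi : IntervalIntegrable g volume 0 c
  · have h1 := (hi.comp_sub_left (2 * c)).symm
    simp only [hg, sub_zero] at h1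
    rw [show 2 * c - c = c by ring] at h1
    have h2 := intervalIntegral.integral_comp_sub_left (a := c) (b := 2 * c) g (2 * c)
    simp only [hg, sub_self] at h2
    rw [show 2 * c - c = c by ring] at h2
    rw [← intervalIntegral.integral_add_adjacent_intervals hi h1, h2]
    ring
  · rw [intervalIntegral.integral_undef hi, intervalIntegral.integral_undef fun h => hi ?_, mul_zero]
    refine h.mono_set ?_
    rw [Set.uIcc_of_le hc, Set.uIcc_of_le (by linarith)]
    exact Set.Icc_subset_Icc_right (by linarith)

/-- The squares differ by 4 sin a sin b. -/
theorem norm_one_add_exp_add_exp_neg_le {a b : ℝ} (ha : a ∈ Set.Icc 0 Real.pi)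
    (hb : b ∈ Set.Icc 0 Real.pi) :
    ‖1 + Complex.exp (a * Complex.I) + Complex.exp ((-b : ℝ) * Complex.I)‖
      ≤ ‖1 + Complex.exp (a * Complex.I) + Complex.exp (b * Complex.I)‖ := by
  refine le_of_sq_le_sq ?_ (norm_nonneg _)
  rw [Complex.sq_norm, Complex.sq_norm, Complex.normSq_apply, Complex.normSq_apply]
  simp only [Complex.add_im, Complex.add_re, Complex.one_im, Complex.one_re,
    Complex.exp_ofReal_mul_I_re, Complex.exp_ofReal_mul_I_im, Real.cos_neg, Real.sin_neg]
  nlinarith [mul_nonneg (Real.sin_nonneg_of_mem_Icc ha) (Real.sin_nonneg_of_mem_Icc hb)]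

theorem exp_two_pi_sub (b : ℝ) : Complex.exp ((2 * Real.pi - b : ℝ) * Complex.I)
    = Complex.exp ((-b : ℝ) * Complex.I) := by
  rw [show ((2 * Real.pi - b : ℝ) : ℂ) * Complex.I = (-b : ℝ) * Complex.I + 2 * Real.pi * Complex.I
    by push_cast; ring, Complex.exp_periodic]

theorem exp_neg_two_pi_sub (b : ℝ) : Complex.exp ((-(2 * Real.pi - b) : ℝ) * Complex.I)
    = Complex.exp (b * Complex.I) := by
  rw [← exp_two_pi_sub]; congr 3; ring

/-- The logarithm of the larger of `|1 + x + y⁻¹|` and `|1 + x + y|` at angles `a`, `b`. -/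
noncomputable def logMaxArc (a b : ℝ) : ℝ :=
  Real.log (max ‖1 + Complex.exp (a * Complex.I) + Complex.exp ((-b : ℝ) * Complex.I)‖
    ‖1 + Complex.exp (a * Complex.I) + Complex.exp (b * Complex.I)‖)

theorem logMaxArc_symm_right (a b : ℝ) : logMaxArc a (2 * Real.pi - b) = logMaxArc a b := by
  rw [logMaxArc, logMaxArc, exp_two_pi_sub, exp_neg_two_pi_sub, max_comm]

theorem logMaxArc_symm_left (a b : ℝ) : logMaxArc (2 * Real.pi - a) b = logMaxArc a b := by
  have h : ∀ t : ℝ, (starRingEnd ℂ) (Complex.exp (t * Complex.I))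
      = Complex.exp ((-t : ℝ) * Complex.I) := fun t => by
    rw [← Complex.exp_conj]; simp
  rw [logMaxArc, logMaxArc, exp_two_pi_sub, max_comm, ← Complex.norm_conj,
    ← Complex.norm_conj (1 + Complex.exp ((-a : ℝ) * Complex.I) + _)]
  simp only [map_add, map_one, h, neg_neg]

theorem integral_logMaxArc :
    ∫ a in (0 : ℝ)..2 * Real.pi, ∫ b in (0 : ℝ)..2 * Real.pi, logMaxArc a b
      = 56 / 3 * zetaThree := by
  have hp := Real.pi_pos.le
  rw [integral_two_mul_of_symm hp fun a => by simp only [logMaxArc_symm_left]]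
  simp only [fun a => integral_two_mul_of_symm hp (logMaxArc_symm_right a)]
  rw [intervalIntegral.integral_const_mul]
  have h : ∫ a in (0 : ℝ)..Real.pi, ∫ b in (0 : ℝ)..Real.pi, logMaxArc a b
      = ∫ a in (0 : ℝ)..Real.pi, ∫ b in (0 : ℝ)..Real.pi,
        Real.log ‖1 + Complex.exp (a * Complex.I) + Complex.exp (b * Complex.I)‖ := by
    refine intervalIntegral.integral_congr fun a ha => ?_
    refine intervalIntegral.integral_congr fun b hb => ?_
    rw [Set.uIcc_of_le hp] at ha hb
    simp only [logMaxArc]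
    rw [max_eq_right (norm_one_add_exp_add_exp_neg_le ha hb)]
  rw [h, integral_log_arc_eq]
  ring

theorem integral_log_max :
    ∫ x in (0 : ℝ)..1, ∫ y in (0 : ℝ)..1, Real.log (max ‖1 + circlePt x + circlePt (-y)‖
      ‖1 + circlePt x + circlePt y‖) = 14 * zetaThree / (3 * Real.pi ^ 2) := by
  have hp := Real.pi_ne_zero
  have e : ∀ x y : ℝ, Real.log (max ‖1 + circlePt x + circlePt (-y)‖
      ‖1 + circlePt x + circlePt y‖) = logMaxArc (2 * Real.pi * x) (2 * Real.pi * y) :=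
    fun x y => by rw [logMaxArc, circlePt, circlePt, circlePt, mul_neg]
  simp only [e, fun x : ℝ => intervalIntegral.integral_comp_mul_left (a := 0) (b := 1)
    (logMaxArc (2 * Real.pi * x)) Real.two_pi_pos.ne', smul_eq_mul]
  rw [intervalIntegral.integral_const_mul, intervalIntegral.integral_comp_mul_left (a := 0) (b := 1)
    (fun a => ∫ b in 2 * Real.pi * 0..2 * Real.pi * 1, logMaxArc a b) Real.two_pi_pos.ne']
  simp only [mul_zero, mul_one]
  rw [integral_logMaxArc]
  simp only [smul_eq_mul]
  field_simp
  ring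

/-! ### Transfer to the unit cube and conclusion -/

/-- The coordinates of a point of `ℝ³`, grouped as `((x, y), z)`. -/
def finThreeEquiv : (Fin 3 → ℝ) ≃ᵐ (ℝ × ℝ) × ℝ :=
  (MeasurableEquiv.piFinSuccAbove (fun _ => ℝ) 2).trans
    (((MeasurableEquiv.refl ℝ).prodCongr MeasurableEquiv.finTwoArrow).trans MeasurableEquiv.prodComm)

theorem finThreeEquiv_apply (θ : Fin 3 → ℝ) : finThreeEquiv θ = ((θ 0, θ 1), θ 2) := rfl

theorem measurePreserving_finThreeEquiv : MeasurePreserving finThreeEquiv := by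
  have h1 := volume_preserving_piFinSuccAbove (fun _ : Fin 3 => ℝ) 2
  have h2 := (MeasurePreserving.id (volume : Measure ℝ)).prod (volume_preserving_finTwoArrow ℝ)
  exact (Measure.measurePreserving_swap.comp h2).comp h1

theorem finThreeEquiv_preimage :
    finThreeEquiv ⁻¹' ((Set.Icc 0 1 ×ˢ Set.Icc 0 1) ×ˢ Set.Icc 0 1) = Set.Icc 0 1 := by
  ext θ
  simp only [Set.mem_preimage, finThreeEquiv_apply, Set.mem_prod, Set.mem_Icc, Pi.le_def,
    Fin.forall_fin_succ, Fin.succ_zero_eq_one, Pi.zero_apply, Pi.one_apply]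
  simp
  tauto

theorem unitMeasure_prod_prod : (unitMeasure.prod unitMeasure).prod unitMeasure
    = (volume : Measure ((ℝ × ℝ) × ℝ)).restrict
      ((Set.Icc 0 1 ×ˢ Set.Icc 0 1) ×ˢ Set.Icc 0 1) := by
  rw [Measure.prod_restrict, Measure.prod_restrict]
  rfl

theorem eval_torusPoint (θ : Fin 3 → ℝ) :
    MvLaurent.eval (torusPoint θ) varX = circlePt (θ 0) ∧
    MvLaurent.eval (torusPoint θ) varY = circlePt (θ 1) ∧
    MvLaurent.eval (torusPoint θ) varYInv = circlePt (-θ 1) ∧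
    MvLaurent.eval (torusPoint θ) varZ = circlePt (θ 2) := by
  have h : ∀ i, ((torusPoint θ i : ℂˣ) : ℂ) = circlePt (θ i) := fun i => by
    rw [torusPoint, Units.val_mk0, circlePt]
    congr 1
    push_cast
    ring
  have h' : circlePt (-θ 1) = (circlePt (θ 1))⁻¹ := by
    rw [circlePt, circlePt, ← Complex.exp_neg]
    congr 1
    push_cast
    ring
  refine ⟨?_, ?_, ?_, ?_⟩ <;>
  simp [MvLaurent.eval, varX, varY, varYInv, varZ, MvLaurent.monomial, Fin.prod_univ_three, h, h']

theorem logMahler_eq {P : MvLaurent 3} {c : ℂ} (hc : ‖c‖ = 1)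
    (hP : ∀ θ : Fin 3 → ℝ, MvLaurent.eval (torusPoint θ) P = 1 + circlePt (θ 0) + circlePt (-θ 1)
      + c * (1 + circlePt (θ 0) + circlePt (θ 1)) * circlePt (θ 2)) :
    IntegrableOn (logAbsOnTorus P) (Set.Icc (0 : Fin 3 → ℝ) 1) ∧
    logMahler P = 14 * zetaThree / (3 * Real.pi ^ 2) := by
  obtain ⟨h1, h2⟩ := integral_prod_log_norm_three hc
  rw [unitMeasure_prod_prod] at h1 h2
  have he : logAbsOnTorus P = (fun p : (ℝ × ℝ) × ℝ => Real.log ‖1 + circlePt p.1.1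
      + circlePt (-p.1.2) + c * (1 + circlePt p.1.1 + circlePt p.1.2) * circlePt p.2‖)
      ∘ finThreeEquiv := by
    funext θ
    simp only [logAbsOnTorus, hP, Function.comp, finThreeEquiv_apply]
  constructor
  · rw [he, ← finThreeEquiv_preimage]
    exact (measurePreserving_finThreeEquiv.integrableOn_comp_preimage
      finThreeEquiv.measurableEmbedding).2 h1
  · rw [logMahler, he, ← finThreeEquiv_preimage, ← integral_log_max, ← h2]
    exact measurePreserving_finThreeEquiv.setIntegral_preimage_emb (E := ℝ)
      finThreeEquiv.measurableEmbedding (fun p : (ℝ × ℝ) × ℝ => Real.log ‖1 + circlePt p.1.1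
        + circlePt (-p.1.2) + c * (1 + circlePt p.1.1 + circlePt p.1.2) * circlePt p.2‖) _

theorem mainTheorem7 :
    (IntegrableOn (logAbsOnTorus (1 + varX + varYInv - (1 + varX + varY) * varZ))
        (Set.Icc (0 : Fin 3 → ℝ) 1) ∧
      IntegrableOn (logAbsOnTorus (1 + varX + varYInv + (1 + varX + varY) * varZ))
        (Set.Icc (0 : Fin 3 → ℝ) 1)) ∧
    4 * Real.pi ^ 2 * logMahler (1 + varX + varYInv - (1 + varX + varY) * varZ)
      = 4 * zagierL 3 1 - 8 * zagierL 3 (-1) + 8 * zagierL 3 3 - 4 * zagierL 3 (-3) ∧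
    ((2 * zagierL 3 3 - zagierL 3 (-3) : ℝ) : ℂ) = 13 / 6 * riemannZeta 3 ∧
    ((logMahler (1 + varX + varYInv - (1 + varX + varY) * varZ) : ℝ) : ℂ)
      = 14 * riemannZeta 3 / (3 * (Real.pi : ℂ) ^ 2) ∧
    ((logMahler (1 + varX + varYInv + (1 + varX + varY) * varZ) : ℝ) : ℂ)
      = 14 * riemannZeta 3 / (3 * (Real.pi : ℂ) ^ 2) := by
  obtain ⟨i1, m1⟩ := logMahler_eq (P := 1 + varX + varYInv - (1 + varX + varY) * varZ) (c := -1)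
    (by simp) (fun θ => by
      obtain ⟨h1, h2, h3, h4⟩ := eval_torusPoint θ
      simp only [map_add, map_sub, map_mul, map_one, h1, h2, h3, h4]
      ring)
  obtain ⟨i2, m2⟩ := logMahler_eq (P := 1 + varX + varYInv + (1 + varX + varY) * varZ) (c := 1)
    (by simp) (fun θ => by
      obtain ⟨h1, h2, h3, h4⟩ := eval_torusPoint θ
      simp only [map_add, map_mul, map_one, h1, h2, h3, h4]
      ring)
  refine ⟨⟨i1, i2⟩, ?_, ?_, ?_, ?_⟩
  · have hp := Real.pi_ne_zero
    -- Both sides are evaluated separately: 4 + 6 + 26/3 = 56/3 = 4 · 14/3, in units of ζ(3).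
    have h : 8 * zagierL 3 3 - 4 * zagierL 3 (-3) = 4 * (13 / 6 * zetaThree) := by
      rw [← zagierL_three_relation]; ring
    rw [m1, add_sub_assoc, h, zagierL_three_one, zagierL_three_neg_one]
    field_simp
    ring
  · rw [zagierL_three_relation, ← ofReal_zetaThree]
    push_cast
    ring
  · rw [m1, ← ofReal_zetaThree]
    push_cast
    ring
  · rw [m2, ← ofReal_zetaThree]
    push_cast
    ring
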